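/- Let $(a_i)_{i\ge1}$ and $(b_i)_{i\ge1}$ be real sequences with $a_i>0$ for $i\ge1$, $b_i>0$ for $i\ge2$ and $b_1=0$. Define $Q_1=1$, $Q_{i+1}=\frac{a_i}{b_{i+1}}Q_i$, and let $z_s\in[0,\infty]$ be the radius of convergence of $\sum_{i\ge1} iQ_iz^i$. Assume that $0<z_s<\infty$, let $0<z<z_s$, put $\mathcal Q_i=Q_iz^i$, and assume $$\sum_{i\ge1} i^2(1+a_i+b_i)^2\mathcal Q_i<\infty,\qquad \inf_{i\ge1}a_i>0,\qquad \lim_{i\to\infty}\frac{Q_{i+1}}{Q_i}=\frac1{z_s},\qquad \lim_{i\to\infty}\frac{a_{i+1}}{a_i}=1 .$$ Let $\mathcal H$ be the real Hilbert space of sequences $h=(h_i)_{i\ge1}$ with $\|h\|^2=\sum_i\mathcal Q_ih_i^2<\infty$ and inner product $\langle f,g\rangle=\sum_i\mathcal Q_if_ig_i$. For compactly supported $h$ let $W_i=a_i\mathcal Q_i\mathcal Q_1(h_i+h_1-h_{i+1})$ and $$L_1(h)=-\frac1{\mathcal Q_1}\Big(W_1+\sum_{k\ge1}W_k\Big),\qquad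 L_i(h)=\frac1{\mathcal Q_i}(W_{i-1}-W_i)\quad(i\ge2).$$ Let $\mathbf L$ be the closure in $\mathcal H$ of the operator $L$ with domain the compactly supported sequences. Let $\sigma_1=3a_1\mathcal Q_1+\sum_{i\ge1}a_i\mathcal Q_i$, $\sigma_i=a_i\mathcal Q_1+b_i$ for $i\ge2$, and $\mathcal H_2=\{h\in\mathcal H:\sum_i\mathcal Q_i(1+\sigma_i^2)h_i^2<\infty\}$. Let $\mathcal E(h,g)=\sum_{i\ge1}a_i\mathcal Q_i\mathcal Q_1(h_{i+1}-h_i-h_1)(g_{i+1}-g_i-g_1)$ on the domain $\mathscr D(\mathcal E)=\{h\in\mathcal H:\mathcal E(h,h)<\infty\}$, and let $\mathcal L$ be the operator associated with this form: $h\in\mathscr D(\mathcal L)$ and $\mathcal Lh=f$ if and only if $h\in\mathscr D(\mathcal E)$, $f\in\mathcal H$ and $\mathcal E(h,g)=-\langle f,g\rangle$ for all $g\in\mathscr D(\mathcal E)$. Then $L$ is closable, $\mathbf L$ is self-adjoint with domain $\mathcal H_2$, and $\mathbf L=\mathcal L$. Moreover there exists $\lambda_0>0$ such that $$\langle\mathbf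 Lh,h\rangle\le-\lambda_0\|h\|^2\qquad\text{for all }h\in\mathcal H_2\text{ with }\sum_{i\ge1}ih_i\mathcal Q_i=0,$$ and $\mathbf L$ is the generator of a $C_0$-semigroup $(\mathcal S_t)_{t\ge0}$ on $\mathcal H$ such that $$\|\mathcal S_th\|\le e^{-\lambda_0t}\|h\|\qquad\text{for all }t\ge0\text{ and all }h\in\mathcal H\text{ with }\sum_{i\ge1}ih_i\mathcal Q_i=0 .$$ -/

import Mathlib

open Filter Topology
open scoped NNReal ENNReal

noncomputable section

namespace BeckerDoering

/-- The detailed balance coefficients: `Q 1 = 1` and `Q (i + 1) = a i / b (i + 1) * Q i`. -/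
def Q (a b : ℕ+ → ℝ) (i : ℕ+) : ℝ :=
  PNat.recOn (p := fun _ => ℝ) i 1 (fun j x => a j / b (j + 1) * x)

theorem Q_one (a b : ℕ+ → ℝ) : Q a b 1 = 1 := PNat.recOn_one _ _

theorem Q_succ (a b : ℕ+ → ℝ) (i : ℕ+) : Q a b (i + 1) = a i / b (i + 1) * Q a b i :=
  PNat.recOn_succ (p := fun _ => ℝ) i _ _

/-- The critical monomer density: the radius of convergence of `∑ i Q_i z ^ i`. -/
def criticalDensity (a b : ℕ+ → ℝ) : ℝ≥0∞ :=
  ⨆ (r : ℝ≥0) (_ : Summable fun i : ℕ+ => (i : ℝ) * Q a b i * (r : ℝ) ^ (i : ℕ)), (r : ℝ≥0∞)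

/-- The data of the linearized problem: coefficients `a`, `b` and equilibrium monomer density `z`,
with the standing assumptions on them. The value `b 1 = 0` is the usual convention. -/
structure Setting where
  /-- coagulation coefficients -/
  a : ℕ+ → ℝ
  /-- fragmentation coefficients -/
  b : ℕ+ → ℝ
  /-- equilibrium monomer density -/
  z : ℝ
  a_pos : ∀ i, 0 < a i
  b_one : b 1 = 0
  b_pos : ∀ i, 1 < i → 0 < b i
  zs_pos : 0 < criticalDensity a b
  z_pos : 0 < z
  z_le : ENNReal.ofReal z ≤ criticalDensity a b
  summable_A :
    Summable fun i : ℕ+ => (i : ℝ) ^ 2 * (1 + a i + b i) ^ 2 * (Q a b i * z ^ (i : ℕ))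

namespace Setting

variable (S : Setting)

/-- The equilibrium `𝒬_i = Q_i z ^ i`. -/
def q (i : ℕ+) : ℝ := Q S.a S.b i * S.z ^ (i : ℕ)

theorem b_succ_pos (i : ℕ+) : 0 < S.b (i + 1) := S.b_pos _ (PNat.lt_add_left 1 i)

theorem b_nonneg (i : ℕ+) : 0 ≤ S.b i := by
  induction i using PNat.recOn with
  | one => rw [S.b_one]
  | succ n _ => exact (S.b_succ_pos n).le

theorem q_pos (i : ℕ+) : 0 < S.q i := by
  have hQ : 0 < Q S.a S.b i := by
    induction i using PNat.recOn with
    | one => rw [Q_one]; exact one_pos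
    | succ n ih =>
      rw [Q_succ]
      exact mul_pos (div_pos (S.a_pos n) (S.b_succ_pos n)) ih
  exact mul_pos hQ (pow_pos S.z_pos _)

theorem q_one : S.q 1 = S.z := by simp [q, Q_one]

/-- Detailed balance. -/
theorem detailed_balance (i : ℕ+) : S.a i * S.q i * S.q 1 = S.b (i + 1) * S.q (i + 1) := by
  rw [q_one, q, q, Q_succ, PNat.add_coe, PNat.one_coe, pow_succ]
  have := (S.b_succ_pos i).ne'
  field_simp

/-! ### The Hilbert space `ℓ²(𝒬)` -/

/-- The sequences `h` with `∑ 𝒬_i h_i ^ 2 < ∞`. -/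
def l2 : Submodule ℝ (ℕ+ → ℝ) where
  carrier := {h | Summable fun i => S.q i * h i ^ 2}
  zero_mem' := by simp [summable_zero]
  add_mem' := by
    intro f g hf hg
    refine Summable.of_nonneg_of_le (fun i => mul_nonneg (S.q_pos i).le (sq_nonneg _))
      (fun i => ?_) ((Summable.add hf hg).mul_left 2)
    have := mul_nonneg (S.q_pos i).le (sq_nonneg (f i - g i))
    simp only [Pi.add_apply]
    nlinarith
  smul_mem' := by
    intro c f hf
    refine (Summable.mul_left (c ^ 2) hf).congr (fun i => ?_)
    simp only [Pi.smul_apply, smul_eq_mul]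
    ring

/-- The space `ℋ = ℓ²(𝒬)`, with inner product `⟪f, g⟫ = ∑ 𝒬_i f_i g_i`. -/
def H : Type := S.l2

instance : AddCommGroup S.H := inferInstanceAs (AddCommGroup S.l2)
instance : Module ℝ S.H := inferInstanceAs (Module ℝ S.l2)
instance : CoeFun S.H (fun _ => ℕ+ → ℝ) := ⟨fun h => h.1⟩

/-- The element of `ℋ` with given entries. -/
def seq (h : ℕ+ → ℝ) (hh : Summable fun i => S.q i * h i ^ 2) : S.H := ⟨h, hh⟩

variable {S}

theorem H_ext {f g : S.H} (h : ∀ i, f i = g i) : f = g := Subtype.ext (funext h)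

@[simp] theorem seq_apply (h : ℕ+ → ℝ) (hh) (i : ℕ+) : S.seq h hh i = h i := rfl
@[simp] theorem add_apply (f g : S.H) (i : ℕ+) : (f + g) i = f i + g i := rfl
@[simp] theorem smul_apply (c : ℝ) (f : S.H) (i : ℕ+) : (c • f) i = c * f i := rfl
@[simp] theorem sub_apply (f g : S.H) (i : ℕ+) : (f - g) i = f i - g i := rfl
@[simp] theorem zero_apply (i : ℕ+) : (0 : S.H) i = 0 := rfl

theorem summable_sq (f : S.H) : Summable fun i => S.q i * f i ^ 2 := f.2

theorem summable_of_sq {w f g : ℕ+ → ℝ} (hw : ∀ i, 0 ≤ w i) (hf : Summable fun i => w i * f i ^ 2)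
    (hg : Summable fun i => w i * g i ^ 2) : Summable fun i => w i * f i * g i := by
  refine Summable.of_norm_bounded (hf.add hg) (fun i => ?_)
  rw [Real.norm_eq_abs, abs_le]
  have h1 := mul_nonneg (hw i) (sq_nonneg (f i - g i))
  have h2 := mul_nonneg (hw i) (sq_nonneg (f i + g i))
  have h3 := mul_nonneg (hw i) (sq_nonneg (f i))
  have h4 := mul_nonneg (hw i) (sq_nonneg (g i))
  constructor <;> nlinarith

theorem summable_mul (f g : S.H) : Summable fun i => S.q i * f i * g i :=
  summable_of_sq (fun i => (S.q_pos i).le) f.2 g.2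

variable (S)

/-- The inner product on `ℋ`. -/
@[reducible] def innerCore : InnerProductSpace.Core ℝ S.H where
  inner f g := ∑' i, S.q i * f i * g i
  conj_inner_symm f g := by
    simp only [conj_trivial]
    exact tsum_congr fun i => by ring
  re_inner_nonneg f := by
    simp only [RCLike.re_to_real]
    exact tsum_nonneg fun i => by
      rw [mul_assoc]; exact mul_nonneg (S.q_pos i).le (mul_self_nonneg _)
  add_left f g h := by
    simp only [add_apply]
    rw [← (summable_mul f h).tsum_add (summable_mul g h)]
    exact tsum_congr fun i => by ring
  smul_left f g c := by
    simp only [smul_apply, conj_trivial]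
    rw [← tsum_mul_left]
    exact tsum_congr fun i => by ring
  definite f hf := by
    have h0 : ∀ i, 0 ≤ S.q i * f i * f i := fun i => by
      rw [mul_assoc]; exact mul_nonneg (S.q_pos i).le (mul_self_nonneg _)
    have h1 := (hasSum_zero_iff_of_nonneg h0).1 (hf ▸ (summable_mul f f).hasSum)
    refine H_ext fun i => ?_
    have h2 : S.q i * f i * f i = 0 := congrFun h1 i
    have h3 := (S.q_pos i).ne'
    simpa [mul_assoc, h3] using h2

instance : NormedAddCommGroup S.H := S.innerCore.toNormedAddCommGroup
instance : InnerProductSpace ℝ S.H := InnerProductSpace.ofCore S.innerCore.toCore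

variable {S}

theorem inner_def (f g : S.H) : inner ℝ f g = ∑' i, S.q i * f i * g i := rfl

theorem norm_sq_def (f : S.H) : ‖f‖ ^ 2 = ∑' i, S.q i * f i ^ 2 := by
  rw [← real_inner_self_eq_norm_sq, inner_def]
  exact tsum_congr fun i => by ring

variable (S)

/-- The isometry `f ↦ (√𝒬_i f_i)` from `ℓ²(𝒬)` onto the unweighted `ℓ²`. -/
def toLp : S.H ≃ₗᵢ[ℝ] lp (fun _ : ℕ+ => ℝ) 2 where
  toFun f := ⟨fun i => √(S.q i) * f i, memℓp_gen ((summable_sq f).congr fun i => by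
    simp [mul_pow, abs_of_nonneg (Real.sqrt_nonneg _), Real.sq_sqrt (S.q_pos i).le])⟩
  invFun g := S.seq (fun i => g i / √(S.q i))
    (((memℓp_gen_iff (by simp)).1 (lp.memℓp g)).congr fun i => by
      have := (S.q_pos i).ne'
      simp only [Real.norm_eq_abs, ENNReal.toReal_ofNat, Real.rpow_ofNat, sq_abs, div_pow,
        Real.sq_sqrt (S.q_pos i).le]
      field_simp)
  map_add' f g := by
    ext i
    exact mul_add _ _ _
  map_smul' c f := by
    ext i
    simp [mul_left_comm]
  left_inv f := H_ext fun i => by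
    have := (Real.sqrt_pos.2 (S.q_pos i)).ne'
    simp [this]
  right_inv g := by
    ext i
    have := (Real.sqrt_pos.2 (S.q_pos i)).ne'
    simp only [seq_apply]
    field_simp
  norm_map' f := by
    refine (sq_eq_sq₀ (norm_nonneg _) (norm_nonneg _)).1 ?_
    rw [norm_sq_def, ← real_inner_self_eq_norm_sq, lp.inner_eq_tsum]
    refine tsum_congr fun i => ?_
    simp only [LinearEquiv.coe_mk, LinearMap.coe_mk, AddHom.coe_mk, real_inner_self_eq_norm_sq,
      Real.norm_eq_abs, sq_abs, mul_pow, Real.sq_sqrt (S.q_pos i).le]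

instance : CompleteSpace S.H :=
  S.toLp.toIsometryEquiv.completeSpace

/-! ### The linearized operator on compactly supported sequences, and its closure -/

/-- The linearized net rates `W_i = a_i 𝒬_i 𝒬_1 (h_i + h_1 - h_{i+1})`. -/
def W (h : ℕ+ → ℝ) (i : ℕ+) : ℝ := S.a i * S.q i * S.q 1 * (h i + h 1 - h (i + 1))

/-- The linearized operator in strong form. -/
def Lfun (h : ℕ+ → ℝ) (i : ℕ+) : ℝ :=
  if i = 1 then -(1 / S.q 1) * (S.W h 1 + ∑' k, S.W h k)
  else 1 / S.q i * (S.W h (i - 1) - S.W h i)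

/-- The compactly supported sequences. -/
def l00 : Submodule ℝ S.H where
  carrier := {h | ∃ N : ℕ+, ∀ i, N ≤ i → h i = 0}
  zero_mem' := ⟨1, fun _ _ => rfl⟩
  add_mem' := by
    rintro f g ⟨N, hN⟩ ⟨M, hM⟩
    refine ⟨max N M, fun i hi => ?_⟩
    rw [add_apply, hN i ((le_max_left _ _).trans hi), hM i ((le_max_right _ _).trans hi), add_zero]
  smul_mem' := by
    rintro c f ⟨N, hN⟩
    exact ⟨N, fun i hi => by rw [smul_apply, hN i hi, mul_zero]⟩

theorem one_le_sq (i : ℕ+) : (1 : ℝ) ≤ (i : ℝ) ^ 2 :=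
  one_le_pow₀ (by exact_mod_cast one_le (a := i))

theorem summable_ab : Summable fun i => (1 + S.a i + S.b i) ^ 2 * S.q i := by
  refine Summable.of_nonneg_of_le (fun i => mul_nonneg (sq_nonneg _) (S.q_pos i).le)
    (fun i => ?_) S.summable_A
  have h := mul_nonneg (sq_nonneg (1 + S.a i + S.b i)) (S.q_pos i).le
  have := mul_le_mul_of_nonneg_right (one_le_sq i) h
  rw [one_mul, ← mul_assoc] at this
  exact this

theorem summable_aq : Summable fun i => S.a i * S.q i := by
  refine Summable.of_nonneg_of_le (fun i => mul_nonneg (S.a_pos i).le (S.q_pos i).le)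
    (fun i => mul_le_mul_of_nonneg_right ?_ (S.q_pos i).le) S.summable_ab
  have h1 := S.a_pos i
  have h2 := S.b_nonneg i
  nlinarith

variable {S}

theorem summable_W {h : S.H} (hh : h ∈ S.l00) : Summable (S.W h) := by
  obtain ⟨N, hN⟩ := hh
  have h1 : Summable fun i => S.a i * S.q i * (S.q 1 * h 1) := S.summable_aq.mul_right _
  refine h1.congr_cofinite ?_
  have : {i | ¬ N ≤ i}.Finite := (Set.finite_lt_nat N).preimage
    (f := fun i : ℕ+ => (i : ℕ)) PNat.coe_injective.injOn |>.subset
      (fun i hi => by simpa using hi)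
  filter_upwards [this.compl_mem_cofinite] with i hi
  have hi' : N ≤ i := by simpa using hi
  rw [W, hN i hi', hN (i + 1) (hi'.trans (PNat.lt_add_right i 1).le)]
  ring

theorem summable_Lfun {h : S.H} (hh : h ∈ S.l00) :
    Summable fun i => S.q i * S.Lfun h i ^ 2 := by
  obtain ⟨N, hN⟩ := hh
  have h1 : Summable fun i => (S.q 1 + 1) ^ 2 * h 1 ^ 2 * ((1 + S.a i + S.b i) ^ 2 * S.q i) :=
    S.summable_ab.mul_left _
  have h2 : Summable fun i => S.q i * ((S.b i - S.a i * S.q 1) * h 1) ^ 2 := by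
    refine Summable.of_nonneg_of_le (fun i => mul_nonneg (S.q_pos i).le (sq_nonneg _))
      (fun i => ?_) h1
    have hA := S.a_pos i
    have hB := S.b_nonneg i
    have hq := S.q_pos 1
    have h3 : (S.b i - S.a i * S.q 1) ^ 2 ≤ ((S.q 1 + 1) * (1 + S.a i + S.b i)) ^ 2 := by
      apply sq_le_sq'
      · nlinarith [mul_pos hA hq, mul_nonneg hB hq.le]
      · nlinarith [mul_pos hA hq, mul_nonneg hB hq.le]
    have h4 := mul_le_mul_of_nonneg_right h3 (mul_nonneg (S.q_pos i).le (sq_nonneg (h 1)))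
    calc _ = (S.b i - S.a i * S.q 1) ^ 2 * (S.q i * h 1 ^ 2) := by ring
      _ ≤ _ := h4
      _ = _ := by ring
  refine h2.congr_cofinite ?_
  have : {i | ¬ N + 1 < i}.Finite := (Set.finite_le_nat (N + 1 : ℕ+)).preimage
    (f := fun i : ℕ+ => (i : ℕ)) PNat.coe_injective.injOn |>.subset
      (fun i hi => by
        have hi' : i ≤ N + 1 := by simpa using hi
        exact hi')
  filter_upwards [this.compl_mem_cofinite] with i hi
  have hi' : N + 1 < i := by simpa using hi
  have hi1 : 1 < i := (PNat.lt_add_left 1 N).trans hi'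
  obtain ⟨j, rfl⟩ : ∃ j, i = j + 1 := ⟨i - 1, (PNat.sub_add_of_lt hi1).symm⟩
  have hj : N ≤ j := (lt_of_add_lt_add_right hi').le
  have hj1 : N ≤ j + 1 := hj.trans (PNat.lt_add_right j 1).le
  have hj2 : N ≤ j + 1 + 1 := hj1.trans (PNat.lt_add_right _ 1).le
  have hq := (S.q_pos (j + 1)).ne'
  have hL : S.Lfun h (j + 1) = (S.b (j + 1) - S.a (j + 1) * S.q 1) * h 1 := by
    rw [Lfun, if_neg hi1.ne', PNat.add_sub, W, W, hN j hj, hN _ hj1, hN _ hj2,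
      S.detailed_balance j]
    field_simp
    ring
  rw [hL]

theorem W_add (f g : ℕ+ → ℝ) (i : ℕ+) : S.W (f + g) i = S.W f i + S.W g i := by
  simp only [W, Pi.add_apply]; ring

theorem W_smul (c : ℝ) (f : ℕ+ → ℝ) (i : ℕ+) : S.W (c • f) i = c * S.W f i := by
  simp only [W, Pi.smul_apply, smul_eq_mul]; ring

variable (S)

/-- The linearized operator, as an operator in `ℋ` with domain the compactly supported
sequences. -/
def L : S.H →ₗ.[ℝ] S.H where
  domain := S.l00
  toFun :=
    { toFun := fun h => S.seq (S.Lfun (h : S.H)) (summable_Lfun h.2)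
      map_add' := fun f g => H_ext fun i => by
        have e : ∀ k, S.W ((f + g : S.l00) : S.H) k = S.W (f : S.H) k + S.W (g : S.H) k :=
          W_add (f : S.H).1 (g : S.H).1
        have := (summable_W f.2).tsum_add (summable_W g.2)
        simp only [seq_apply, add_apply, Lfun, e, this]
        split_ifs <;> ring
      map_smul' := fun c f => H_ext fun i => by
        have e : ∀ k, S.W ((c • f : S.l00) : S.H) k = c * S.W (f : S.H) k :=
          W_smul c (f : S.H).1
        simp only [seq_apply, smul_apply, Lfun, e, tsum_mul_left, RingHom.id_apply]
        split_ifs <;> ring }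

/-- The operator `𝐋`: the closure of `L` in `ℋ`. -/
def Lclosure : S.H →ₗ.[ℝ] S.H := S.L.closure

/-- `σ_1 = 3 a_1 𝒬_1 + ∑ a_i 𝒬_i` and `σ_i = a_i 𝒬_1 + b_i` for `i ≥ 2`. -/
def sigma (i : ℕ+) : ℝ :=
  if i = 1 then 3 * S.a 1 * S.q 1 + ∑' k, S.a k * S.q k else S.a i * S.q 1 + S.b i

/-- The space `ℋ₂ = ℓ²(𝒬 (1 + σ²))`. -/
def H2 : Set S.H := {h | Summable fun i => S.q i * (1 + S.sigma i ^ 2) * h i ^ 2}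

/-! ### The quadratic form and its operator -/

/-- The domain `{h ∈ ℋ | 𝓔(h, h) < ∞}` of the form. -/
def formDomain : Submodule ℝ S.H where
  carrier := {h | Summable fun i => S.a i * S.q i * S.q 1 * (h (i + 1) - h i - h 1) ^ 2}
  zero_mem' := by simp [summable_zero]
  add_mem' := by
    intro f g hf hg
    refine Summable.of_nonneg_of_le (fun i => ?_) (fun i => ?_) ((Summable.add hf hg).mul_left 2)
    · exact mul_nonneg (mul_pos (mul_pos (S.a_pos i) (S.q_pos i)) (S.q_pos 1)).le (sq_nonneg _)
    · have := mul_nonneg (mul_pos (mul_pos (S.a_pos i) (S.q_pos i)) (S.q_pos 1)).le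
        (sq_nonneg ((f (i + 1) - f i - f 1) - (g (i + 1) - g i - g 1)))
      simp only [add_apply]
      nlinarith
  smul_mem' := by
    intro c f hf
    refine (Summable.mul_left (c ^ 2) hf).congr (fun i => ?_)
    simp only [smul_apply]
    ring

/-- The form `𝓔(h, g) = ∑ a_i 𝒬_i 𝒬_1 (h_{i+1} - h_i - h_1) (g_{i+1} - g_i - g_1)`. -/
def form (h g : S.H) : ℝ :=
  ∑' i, S.a i * S.q i * S.q 1 * (h (i + 1) - h i - h 1) * (g (i + 1) - g i - g 1)

variable {S}

theorem summable_form {h g : S.H} (hh : h ∈ S.formDomain) (hg : g ∈ S.formDomain) :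
    Summable fun i =>
      S.a i * S.q i * S.q 1 * (h (i + 1) - h i - h 1) * (g (i + 1) - g i - g 1) :=
  summable_of_sq (fun i => (mul_pos (mul_pos (S.a_pos i) (S.q_pos i)) (S.q_pos 1)).le) hh hg

theorem l00_le_formDomain : S.l00 ≤ S.formDomain := by
  rintro h ⟨N, hN⟩
  have h1 : Summable fun i => S.a i * S.q i * (S.q 1 * h 1 ^ 2) := S.summable_aq.mul_right _
  refine h1.congr_cofinite ?_
  have : {i | ¬ N ≤ i}.Finite := (Set.finite_lt_nat N).preimage
    (f := fun i : ℕ+ => (i : ℕ)) PNat.coe_injective.injOn |>.subset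
      (fun i hi => by simpa using hi)
  filter_upwards [this.compl_mem_cofinite] with i hi
  have hi' : N ≤ i := by simpa using hi
  rw [hN i hi', hN (i + 1) (hi'.trans (PNat.lt_add_right i 1).le)]
  ring

variable (S)

/-- The graph of the operator associated with the form: the pairs `(h, f)` with `h` in the form
domain, `f` in `ℋ` and `𝓔(h, g) = -⟪f, g⟫` for every `g` in the form domain. -/
def formGraph : Submodule ℝ (S.H × S.H) where
  carrier := {p | p.1 ∈ S.formDomain ∧ ∀ g ∈ S.formDomain, S.form p.1 g = -inner ℝ p.2 g}
  zero_mem' := ⟨zero_mem _, fun g _ => by simp [form]⟩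
  add_mem' := by
    rintro p p' ⟨h1, h2⟩ ⟨h1', h2'⟩
    refine ⟨add_mem h1 h1', fun g hg => ?_⟩
    rw [Prod.snd_add, inner_add_left, neg_add, ← h2 g hg, ← h2' g hg, form, form, form,
      ← (summable_form h1 hg).tsum_add (summable_form h1' hg)]
    exact tsum_congr fun i => by simp only [Prod.fst_add, add_apply]; ring
  smul_mem' := by
    rintro c p ⟨h1, h2⟩
    refine ⟨Submodule.smul_mem _ c h1, fun g hg => ?_⟩
    rw [Prod.smul_snd, real_inner_smul_left, ← mul_neg, ← h2 g hg, form, form, ← tsum_mul_left]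
    exact tsum_congr fun i => by simp only [Prod.smul_fst, smul_apply]; ring

/-- The operator `𝓛` associated with the form `𝓔`. -/
def formOperator : S.H →ₗ.[ℝ] S.H := S.formGraph.toLinearPMap

theorem formOperator_graph : S.formOperator.graph = S.formGraph := by
  refine Submodule.toLinearPMap_graph_eq _ ?_
  rintro ⟨h, f⟩ ⟨-, hf⟩ rfl
  refine H_ext fun i => ?_
  have hs : (Function.support fun j => S.q j * (Pi.single i 1 : ℕ+ → ℝ) j ^ 2).Finite :=
    (Set.finite_singleton i).subset fun j hj => by
      by_contra hne
      exact hj (by simp [Pi.single_eq_of_ne hne])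
  have he : S.seq (Pi.single i 1) (summable_of_hasFiniteSupport hs) ∈ S.l00 :=
    ⟨i + 1, fun j hj => Pi.single_eq_of_ne
      ((PNat.lt_add_right i 1).trans_le hj).ne' _⟩
  have h1 := hf _ (l00_le_formDomain he)
  have h2 : S.form 0 (S.seq (Pi.single i 1) (summable_of_hasFiniteSupport hs)) = 0 := by
    simp [form]
  rw [h2, inner_def, tsum_eq_single i (fun j hj => by simp [Pi.single_eq_of_ne hj])] at h1
  have := (S.q_pos i).ne'
  simpa [this] using h1

/-- The sequences `h` whose mass `∑ i 𝒬_i h_i` vanishes (the sum converges absolutely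
on `ℋ`). -/
def massZero : Set S.H := {h | ∑' i : ℕ+, (i : ℝ) * h i * S.q i = 0}

theorem summable_mass (h : S.H) : Summable fun i : ℕ+ => (i : ℝ) * h i * S.q i := by
  have h1 : Summable fun i : ℕ+ => S.q i * (i : ℝ) ^ 2 := by
    refine Summable.of_nonneg_of_le (fun i => mul_nonneg (S.q_pos i).le (sq_nonneg _))
      (fun i => ?_) S.summable_A
    have hA := S.a_pos i
    have hB := S.b_nonneg i
    have h2 : (1 : ℝ) ≤ (1 + S.a i + S.b i) ^ 2 := one_le_pow₀ (by linarith)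
    have h3 := mul_le_mul_of_nonneg_right h2 (mul_nonneg (S.q_pos i).le (sq_nonneg (i : ℝ)))
    calc _ = 1 * (S.q i * (i : ℝ) ^ 2) := (one_mul _).symm
      _ ≤ _ := h3
      _ = (i : ℝ) ^ 2 * (1 + S.a i + S.b i) ^ 2 * S.q i := by ring
  refine (summable_of_sq (fun i => (S.q_pos i).le) h1 (summable_sq h)).congr fun i => by ring

end Setting

/-! ### Strongly continuous semigroups -/

/-- A strongly continuous semigroup of bounded operators. -/
structure C0Semigroup (X : Type*) [NormedAddCommGroup X] [NormedSpace ℝ X] where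
  /-- the operator at time `t` -/
  op : ℝ≥0 → X →L[ℝ] X
  op_zero : op 0 = ContinuousLinearMap.id ℝ X
  op_add : ∀ s t, op (s + t) = (op s).comp (op t)
  continuous_op : ∀ x, Continuous fun t => op t x

namespace C0Semigroup

variable {X : Type*} [NormedAddCommGroup X] [NormedSpace ℝ X] (T : C0Semigroup X)

/-- The graph of the infinitesimal generator: the pairs `(x, y)` with
`y = lim_{t → 0+} (T_t x - x) / t`. -/
def generatorGraph : Submodule ℝ (X × X) where
  carrier := {p | Tendsto (fun t : ℝ≥0 => (t : ℝ)⁻¹ • (T.op t p.1 - p.1)) (𝓝[>] 0) (𝓝 p.2)}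
  zero_mem' := by simp
  add_mem' := by
    intro p p' h h'
    refine (Tendsto.add h h').congr fun t => ?_
    simp only [Prod.fst_add, map_add, ← smul_add]
    congr 1
    abel
  smul_mem' := by
    intro c p h
    refine (Tendsto.const_smul h c).congr fun t => ?_
    simp only [Prod.smul_fst, map_smul]
    rw [smul_comm, smul_sub]

/-- The infinitesimal generator, defined for those `x` for which the limit exists. -/
def generator : X →ₗ.[ℝ] X := T.generatorGraph.toLinearPMap

theorem generator_graph : T.generator.graph = T.generatorGraph := by
  refine Submodule.toLinearPMap_graph_eq _ ?_
  rintro ⟨x, y⟩ hy rfl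
  have hy' : Tendsto (fun t : ℝ≥0 => (t : ℝ)⁻¹ • (T.op t 0 - 0)) (𝓝[>] 0) (𝓝 y) := hy
  simp only [map_zero, sub_zero, smul_zero] at hy'
  exact tendsto_nhds_unique hy' tendsto_const_nhds

end C0Semigroup

end BeckerDoering

end

/-! Write `Lfun h = -σ h + B h`, where `B` collects the two off-diagonals and the terms carrying `h
1`, together with the first row. By detailed balance the weighted square of either off-diagonal
entry, measured against the diagonal, is governed by `a_j 𝒬_1 b_{j+1} / σ²`. The assumed limits give
`b_{j+1} / a_j → z_s` and `a_{j+1} / a_j → 1`, so this quotient tends to `z z_s / (z + z_s)²`, which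
is below `1/4` because `z < z_s`. Two off-diagonals cost a factor `4`, hence `B` is bounded relative
to `σ` with relative bound below one (`exists_offDiag_bound`), the remaining terms being controlled
by `‖h‖`.

Consequently, for large `c`, `c - L = (1 - K)(σ + c)` with `K = B (σ + c)⁻¹` of norm below one, so a
Neumann series makes `c - L` map `H2` onto `ℋ` (`exists_parametrization`). Summation by parts shows
that the form operator extends `Lfun` on `H2`. It is symmetric and dissipative, so `c - 𝓛` is
injective: its domain is exactly `H2`, it is self-adjoint, and a density argument through the
parametrization identifies it with the closure of `L`.

For the gap, subtract `h 1` times the sequence `iota`, `i ↦ i`, on which the form vanishes. The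
difference is zero at `1` and a discrete Hardy inequality (`exists_hardy`) applies, since `𝒬` decays
geometrically. Orthogonality of `h` to `iota` gives the bound for `h` itself. The semigroup comes
from Yosida approximation (`exists_contraction_semigroup`), and its decay from differentiating `‖T_t
h‖²` on the invariant subspace `iota^⊥`. -/

noncomputable section

namespace BeckerDoering

/-! ### Semigroups generated by bounded dissipative operators -/

section BoundedGenerator

variable {X : Type*} [NormedAddCommGroup X] [InnerProductSpace ℝ X]

/-- The semigroup `exp (t B)` of a bounded operator. -/
def expOp (B : X →L[ℝ] X) (t : ℝ) : X →L[ℝ] X := NormedSpace.exp (t • B)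

theorem expOp_zero (B : X →L[ℝ] X) : expOp B 0 = ContinuousLinearMap.id ℝ X := by
  rw [expOp, zero_smul, NormedSpace.exp_zero]; rfl

theorem expOp_add [CompleteSpace X] (B : X →L[ℝ] X) (s t : ℝ) (x : X) :
    expOp B (s + t) x = expOp B s (expOp B t x) := by
  let _ : NormedAlgebra ℚ (X →L[ℝ] X) := NormedAlgebra.restrictScalars ℚ ℝ _
  rw [expOp, add_smul, NormedSpace.exp_add_of_commute]
  · rfl
  · exact ((Commute.refl B).smul_left s).smul_right t

theorem expOp_commute {B C : X →L[ℝ] X} (h : Commute B C) (t : ℝ) (x : X) :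
    expOp B t (C x) = C (expOp B t x) := by
  have h1 : Commute (expOp B t) C := ((h.smul_left t)).exp_left
  exact congrArg (fun F : X →L[ℝ] X => F x) h1.eq

theorem hasDerivAt_expOp [CompleteSpace X] (B : X →L[ℝ] X) (t : ℝ) :
    HasDerivAt (expOp B) (expOp B t * B) t :=
  hasDerivAt_exp_smul_const B t

theorem hasDerivAt_expOp_apply [CompleteSpace X] (B : X →L[ℝ] X) (x : X) (t : ℝ) :
    HasDerivAt (fun t => expOp B t x) (expOp B t (B x)) t :=
  (ContinuousLinearMap.apply ℝ X x).hasFDerivAt.comp_hasDerivAt t (hasDerivAt_expOp B t)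

/-- The derivative of `‖exp (s B) x‖²` is twice the pairing of `B u` with `u = exp (s B) x`, hence
nonpositive. -/
theorem norm_expOp_apply_le [CompleteSpace X] {B : X →L[ℝ] X} (hB : ∀ x, inner ℝ (B x) x ≤ 0) {t : ℝ} (ht : 0 ≤ t)
    (x : X) : ‖expOp B t x‖ ≤ ‖x‖ := by
  have hd : ∀ s, HasDerivAt (fun s => ‖expOp B s x‖ ^ 2)
      (2 * inner ℝ (expOp B s x) (expOp B s (B x))) s :=
    fun s => (hasDerivAt_expOp_apply B x s).norm_sq
  have ha : Antitone fun s => ‖expOp B s x‖ ^ 2 :=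
    antitone_of_deriv_nonpos (fun s => (hd s).differentiableAt) fun s => by
      rw [(hd s).deriv, expOp_commute (Commute.refl B), real_inner_comm]
      linarith [hB (expOp B s x)]
  have := ha ht
  simp only [expOp_zero, ContinuousLinearMap.id_apply] at this
  exact (sq_le_sq₀ (norm_nonneg _) (norm_nonneg _)).1 this

/-- Interpolate along `s ↦ exp (s B) exp ((t - s) C) x`. Commutation turns its derivative into two
contractions applied to `B x - C x`, so the bound does not involve the norms of `B` and `C`. -/
theorem norm_expOp_sub_expOp_le [CompleteSpace X] {B C : X →L[ℝ] X} (hB : ∀ x, inner ℝ (B x) x ≤ 0)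
    (hC : ∀ x, inner ℝ (C x) x ≤ 0) (hBC : Commute B C) {t : ℝ} (ht : 0 ≤ t) (x : X) :
    ‖expOp B t x - expOp C t x‖ ≤ t * ‖B x - C x‖ := by
  have hd : ∀ s ∈ Set.Icc 0 t, HasDerivWithinAt (fun s => expOp B s (expOp C (t - s) x))
      (expOp B s (expOp C (t - s) (B x - C x))) (Set.Icc 0 t) s := by
    intro s _
    have h1 : HasDerivAt (fun s => expOp C (t - s) x) (-(expOp C (t - s) (C x))) s :=
      ((hasDerivAt_expOp_apply C x (t - s)).scomp s
        ((hasDerivAt_id s).const_sub t)).congr_deriv (by simp)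
    have h2 := (hasDerivAt_expOp B s).clm_apply h1
    refine h2.hasDerivWithinAt.congr_deriv ?_
    rw [map_sub, map_sub, map_neg, ← sub_eq_add_neg, expOp_commute hBC.symm]
    rfl
  have := norm_image_sub_le_of_norm_deriv_le_segment' hd (C := ‖B x - C x‖) (fun s hs =>
    (norm_expOp_apply_le hB hs.1 _).trans (norm_expOp_apply_le hC (sub_nonneg.2 hs.2.le) _)) t
    ⟨ht, le_rfl⟩
  simpa [expOp_zero, mul_comm] using this

theorem norm_expOp_sub_self_le [CompleteSpace X] {B : X →L[ℝ] X} (hB : ∀ x, inner ℝ (B x) x ≤ 0) {t : ℝ}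
    (ht : 0 ≤ t) (x : X) : ‖expOp B t x - x‖ ≤ t * ‖B x‖ := by
  have h0 : expOp (0 : X →L[ℝ] X) t x = x := by simp [expOp]
  simpa [h0] using norm_expOp_sub_expOp_le hB (C := 0) (by simp) (Commute.zero_right B) ht x

/-- Differentiability at `0` with constants that survive the Yosida limit. It is used with `y = A
x`, which may lie outside the domain of `A`; the auxiliary `y'` is a nearby point of the domain,
where `B y'` stays bounded. -/
theorem norm_expOp_sub_sub_le [CompleteSpace X] {B : X →L[ℝ] X} (hB : ∀ x, inner ℝ (B x) x ≤ 0) {t : ℝ}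
    (ht : 0 ≤ t) (x y y' : X) :
    ‖expOp B t x - x - t • y‖ ≤ t * (‖B x - y‖ + 2 * ‖y - y'‖ + t * ‖B y'‖) := by
  have hd : ∀ s ∈ Set.Icc 0 t, HasDerivWithinAt (fun s => expOp B s x - s • y)
      (expOp B s (B x) - y) (Set.Icc 0 t) s := by
    intro s _
    exact (((hasDerivAt_expOp_apply B x s).sub
      ((hasDerivAt_id s).smul_const y)).congr_deriv (by simp)).hasDerivWithinAt
  have := norm_image_sub_le_of_norm_deriv_le_segment' hd
    (C := ‖B x - y‖ + 2 * ‖y - y'‖ + t * ‖B y'‖) (fun s hs => ?_) t ⟨ht, le_rfl⟩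
  · simp only [expOp_zero, ContinuousLinearMap.id_apply, zero_smul, sub_zero] at this
    rw [sub_right_comm, mul_comm t]
    exact this
  · have e : expOp B s (B x) - y = expOp B s (B x - y) + expOp B s (y - y')
        + (expOp B s y' - y') + (y' - y) := by
      simp only [map_sub]; abel
    rw [e]
    have h1 := norm_expOp_apply_le hB hs.1 (B x - y)
    have h2 := norm_expOp_apply_le hB hs.1 (y - y')
    have h3 := norm_expOp_sub_self_le hB hs.1 y'
    have h4 := mul_le_mul_of_nonneg_right hs.2.le (norm_nonneg (B y'))
    have h5 := norm_sub_rev y y'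
    have := norm_add₄_le (a := expOp B s (B x - y)) (b := expOp B s (y - y'))
      (c := expOp B s y' - y') (d := y' - y)
    linarith

end BoundedGenerator

/-! ### The Hille-Yosida theorem for dissipative operators in a Hilbert space -/

section HilleYosida

variable {X : Type*} [NormedAddCommGroup X] [InnerProductSpace ℝ X]

/-- Dissipativity gives the resolvent estimate. -/
theorem mul_norm_le_of_dissipative {A : X →ₗ.[ℝ] X} (hA : ∀ x : A.domain, inner ℝ (A x) (x : X) ≤ 0)
    (c : ℝ) (x : A.domain) : c * ‖(x : X)‖ ≤ ‖c • (x : X) - A x‖ := by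
  rcases (norm_nonneg (x : X)).eq_or_lt with h0 | h0
  · rw [← h0, mul_zero]; exact norm_nonneg _
  · have h1 := real_inner_le_norm (c • (x : X) - A x) (x : X)
    rw [inner_sub_left, real_inner_smul_left, real_inner_self_eq_norm_sq] at h1
    have h2 := hA x
    nlinarith

theorem eq_of_smul_sub_eq {A : X →ₗ.[ℝ] X} (hA : ∀ x : A.domain, inner ℝ (A x) (x : X) ≤ 0)
    {c : ℝ} (hc : 0 < c) {x y : A.domain} (h : c • (x : X) - A x = c • (y : X) - A y) : x = y := by
  have h1 := mul_norm_le_of_dissipative hA c (x - y)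
  have e : c • ((x - y : A.domain) : X) - A (x - y) = 0 := by
    rw [LinearPMap.map_sub, AddSubgroupClass.coe_sub, smul_sub, sub_sub_sub_comm, h, sub_self]
  rw [e, norm_zero] at h1
  have h2 : ‖((x - y : A.domain) : X)‖ = 0 := le_antisymm (by nlinarith) (norm_nonneg _)
  exact Subtype.ext (sub_eq_zero.1 (by simpa using h2))

/-- The resolvent `(c - A)⁻¹` of a dissipative operator with `c - A` onto. -/
theorem exists_resolvent {A : X →ₗ.[ℝ] X} (hA : ∀ x : A.domain, inner ℝ (A x) (x : X) ≤ 0)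
    {c : ℝ} (hc : 0 < c) (hs : ∀ y, ∃ x : A.domain, c • (x : X) - A x = y) :
    ∃ R : X →L[ℝ] X, (∀ y, ∃ x : A.domain, (x : X) = R y ∧ c • (x : X) - A x = y) ∧
      (∀ x : A.domain, R (c • (x : X) - A x) = x) ∧ ∀ y, c * ‖R y‖ ≤ ‖y‖ := by
  choose r hr using hs
  have hr' : ∀ x : A.domain, r (c • (x : X) - A x) = x := fun x => eq_of_smul_sub_eq hA hc (hr _)
  let R0 : X →ₗ[ℝ] X :=
    { toFun := fun y => r y
      map_add' := fun y y' => by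
        have : r (y + y') = r y + r y' := by
          rw [← hr' (r y + r y')]
          congr 1
          rw [LinearPMap.map_add, Submodule.coe_add, smul_add, add_sub_add_comm, hr, hr]
        rw [this]; rfl
      map_smul' := fun k y => by
        have : r (k • y) = k • r y := by
          rw [← hr' (k • r y)]
          congr 1
          rw [LinearPMap.map_smul, Submodule.coe_smul, smul_comm, ← smul_sub, hr]
        rw [this]; rfl }
  have hb : ∀ y, c * ‖R0 y‖ ≤ ‖y‖ := fun y => by
    have := mul_norm_le_of_dissipative hA c (r y)
    rwa [hr] at this
  refine ⟨R0.mkContinuous c⁻¹ fun y => ?_, fun y => ⟨r y, rfl, hr y⟩, fun x => ?_, hb⟩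
  · rw [inv_mul_eq_div, le_div_iff₀ hc, mul_comm]; exact hb y
  · exact congrArg Subtype.val (hr' x)

theorem tendsto_self_of_dense {ι : Type*} {l : Filter ι} {F : ι → X →L[ℝ] X} {D : Set X}
    (hD : Dense D) (hF : ∀ i x, ‖F i x‖ ≤ ‖x‖) (h : ∀ x ∈ D, Tendsto (fun i => F i x) l (𝓝 x))
    (x : X) : Tendsto (fun i => F i x) l (𝓝 x) := by
  rw [Metric.tendsto_nhds]
  intro ε hε
  obtain ⟨y, hy, hxy⟩ := hD.exists_dist_lt x (show 0 < ε / 3 by positivity)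
  filter_upwards [Metric.tendsto_nhds.1 (h y hy) (ε / 3) (by positivity)] with i hi
  have h1 : dist (F i x) (F i y) ≤ dist x y := by
    rw [dist_eq_norm, dist_eq_norm, ← map_sub]; exact hF i _
  have := dist_triangle4 (F i x) (F i y) y x
  rw [dist_comm y x] at this
  linarith

theorem cauchySeq_of_dense {F : ℕ → X →L[ℝ] X} {D : Set X} (hD : Dense D)
    (hF : ∀ i x, ‖F i x‖ ≤ ‖x‖) (h : ∀ x ∈ D, CauchySeq fun n => F n x) (x : X) :
    CauchySeq fun n => F n x := by
  rw [Metric.cauchySeq_iff]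
  intro ε hε
  obtain ⟨y, hy, hxy⟩ := hD.exists_dist_lt x (show 0 < ε / 3 by positivity)
  obtain ⟨N, hN⟩ := Metric.cauchySeq_iff.1 (h y hy) (ε / 3) (by positivity)
  refine ⟨N, fun m hm n hn => ?_⟩
  have h1 : ∀ i, dist (F i x) (F i y) ≤ dist x y := fun i => by
    rw [dist_eq_norm, dist_eq_norm, ← map_sub]; exact hF i _
  have h2 := dist_triangle4 (F m x) (F m y) (F n y) (F n x)
  rw [dist_comm (F n y)] at h2
  linarith [h1 m, h1 n, hN m hm n hn]

/-- The Yosida approximation `c (c R - 1)`, where `R = (c - A)⁻¹`. -/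
def yosida (c : ℝ) (R : X →L[ℝ] X) : X →L[ℝ] X := c • (c • R - ContinuousLinearMap.id ℝ X)

theorem yosida_apply (c : ℝ) (R : X →L[ℝ] X) (x : X) : yosida c R x = c • (c • R x - x) := rfl

theorem inner_yosida_le {c : ℝ} (hc : 0 ≤ c) {R : X →L[ℝ] X} (hR : ∀ y, c * ‖R y‖ ≤ ‖y‖) (x : X) :
    inner ℝ (yosida c R x) x ≤ 0 := by
  rw [yosida_apply, real_inner_smul_left, inner_sub_left, real_inner_smul_left,
    real_inner_self_eq_norm_sq]
  refine mul_nonpos_of_nonneg_of_nonpos hc ?_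
  have h1 := mul_le_mul_of_nonneg_left (real_inner_le_norm (R x) x) hc
  have h2 := mul_le_mul_of_nonneg_right (hR x) (norm_nonneg x)
  nlinarith

variable {A : X →ₗ.[ℝ] X}

/-- The resolvent identity, written once from each side (`e1` and `e2`), forces the two resolvents
to commute. -/
theorem yosida_commute {c d : ℝ} {R R' : X →L[ℝ] X} (hcd : c ≠ d)
    (h1 : ∀ y, ∃ x : A.domain, (x : X) = R y ∧ c • (x : X) - A x = y)
    (h2 : ∀ x : A.domain, R (c • (x : X) - A x) = x)
    (h1' : ∀ y, ∃ x : A.domain, (x : X) = R' y ∧ d • (x : X) - A x = y)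
    (h2' : ∀ x : A.domain, R' (d • (x : X) - A x) = x) :
    Commute (yosida c R) (yosida d R') := by
  have key : ∀ y, R (R' y) = R' (R y) := fun y => by
    obtain ⟨v, hv, hvy⟩ := h1' y
    obtain ⟨u, hu, huy⟩ := h1 y
    have e1 : R' y = R y + (c - d) • R (R' y) := by
      have := h2 v
      rw [show c • (v : X) - A v = y + (c - d) • (v : X) by rw [← hvy]; module, map_add, map_smul,
        hv] at this
      exact this.symm
    have e2 : R y = R' y + (d - c) • R' (R y) := by
      have := h2' u
      rw [show d • (u : X) - A u = y + (d - c) • (u : X) by rw [← huy]; module, map_add, map_smul,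
        hu] at this
      exact this.symm
    have e3 : (c - d) • (R (R' y) - R' (R y)) = 0 := by
      calc (c - d) • (R (R' y) - R' (R y))
          = (R y + (c - d) • R (R' y)) + (R' y + (d - c) • R' (R y)) - R y - R' y := by module
        _ = 0 := by rw [← e1, ← e2]; abel
    exact sub_eq_zero.1 ((smul_eq_zero.1 e3).resolve_left (sub_ne_zero.2 hcd))
  have hRR : Commute R R' := ContinuousLinearMap.ext key
  have h3 : Commute (c • R - 1) (d • R' - 1) :=
    (((hRR.smul_left c).smul_right d).sub_right (Commute.one_right _)).sub_left
      (Commute.one_left _)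
  exact (h3.smul_left c).smul_right d

/-- A densely defined dissipative operator `A` in a Hilbert space such that `c - A` is onto for all
large `c` generates a contraction semigroup. -/
theorem exists_contraction_semigroup [CompleteSpace X] (hd : Dense (A.domain : Set X))
    (hA : ∀ x : A.domain, inner ℝ (A x) (x : X) ≤ 0) {c₀ : ℝ}
    (hs : ∀ c, c₀ < c → ∀ y, ∃ x : A.domain, c • (x : X) - A x = y) :
    ∃ T : C0Semigroup X, T.generator = A ∧ ∀ t x, ‖T.op t x‖ ≤ ‖x‖ := by
  -- A sequence that is positive, exceeds `c₀` and tends to infinity.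
  let c : ℕ → ℝ := fun n => |c₀| + 1 + n
  have hc : ∀ n, 0 < c n := fun n => by positivity
  have hc0 : ∀ n, c₀ < c n := fun n => by
    have h1 : (0 : ℝ) ≤ n := n.cast_nonneg
    have h2 := le_abs_self c₀
    simp only [c]; linarith
  have hct : Tendsto c atTop atTop := tendsto_atTop_add_const_left _ _ tendsto_natCast_atTop_atTop
  choose R hR1 hR2 hR3 using fun n => exists_resolvent hA (hc n) (hs (c n) (hc0 n))
  let B : ℕ → X →L[ℝ] X := fun n => yosida (c n) (R n)
  have hB : ∀ n x, inner ℝ (B n x) x ≤ 0 := fun n => inner_yosida_le (hc n).le (hR3 n)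
  have hBB : ∀ n m, Commute (B n) (B m) := fun n m => by
    rcases eq_or_ne n m with rfl | hnm
    · exact Commute.refl _
    · exact yosida_commute (A := A) (by simpa [c] using hnm) (hR1 n) (hR2 n) (hR1 m) (hR2 m)
  -- On the domain `c R x - x = R (A x)`, of norm at most `‖A x‖ / c`; density and `‖c R‖ ≤ 1` do
  -- the rest.
  have hcR : ∀ y, Tendsto (fun n => (c n • R n) y) atTop (𝓝 y) := by
    refine tendsto_self_of_dense hd (fun n x => ?_) fun x hx => ?_
    · rw [_root_.smul_apply, norm_smul, Real.norm_eq_abs, abs_of_pos (hc n)]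
      exact hR3 n x
    · rw [tendsto_iff_norm_sub_tendsto_zero]
      refine squeeze_zero (fun _ => norm_nonneg _) (fun n => ?_)
        ((tendsto_const_nhds (x := ‖A ⟨x, hx⟩‖)).div_atTop hct)
      have h1 : (c n • R n) x - x = R n (A ⟨x, hx⟩) := by
        have := hR2 n ⟨x, hx⟩
        rw [map_sub, map_smul] at this
        rw [_root_.smul_apply, sub_eq_iff_eq_add]
        exact (sub_eq_iff_eq_add'.1 this)
      rw [h1, le_div_iff₀ (hc n), mul_comm]
      exact hR3 n _
  -- On the domain the Yosida approximation equals `c R (A x)`.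
  have hBA : ∀ x : A.domain, Tendsto (fun n => B n x) atTop (𝓝 (A x)) := fun x => by
    refine (hcR (A x)).congr fun n => ?_
    have := hR2 n x
    rw [map_sub, map_smul] at this
    have h1 : c n • R n x - x = R n (A x) := by
      rw [sub_eq_iff_eq_add]; exact sub_eq_iff_eq_add'.1 this
    simp only [B]
    rw [yosida_apply, h1]
    rfl
  have hlim : ∀ (t : ℝ≥0) x, ∃ y, Tendsto (fun n => expOp (B n) t x) atTop (𝓝 y) := fun t x => by
    refine cauchySeq_tendsto_of_complete (cauchySeq_of_dense hd
      (fun n => norm_expOp_apply_le (hB n) t.2) (fun x hx => ?_) x)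
    have h1 := (hBA ⟨x, hx⟩).cauchySeq
    rw [Metric.cauchySeq_iff] at h1 ⊢
    intro ε hε
    obtain ⟨N, hN⟩ := h1 (ε / (t + 1)) (by positivity)
    refine ⟨N, fun m hm n hn => ?_⟩
    have h2 := hN m hm n hn
    rw [lt_div_iff₀ (by positivity)] at h2
    have h3 := norm_expOp_sub_expOp_le (hB m) (hB n) (hBB m n) t.2 x
    rw [dist_eq_norm] at h2 ⊢
    have : (t : ℝ) * ‖B m x - B n x‖ ≤ ‖B m x - B n x‖ * (t + 1) := by
      nlinarith [norm_nonneg (B m x - B n x)]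
    exact (h3.trans this).trans_lt h2
  choose f hf using hlim
  let S : ℝ≥0 → X →L[ℝ] X := fun t => continuousLinearMapOfTendsto (fun n => expOp (B n) t)
    (tendsto_pi_nhds.2 (hf t))
  have hS : ∀ (t : ℝ≥0) x, Tendsto (fun n => expOp (B n) t x) atTop (𝓝 (S t x)) := hf
  have hS1 : ∀ (t : ℝ≥0) x, ‖S t x‖ ≤ ‖x‖ := fun t x =>
    le_of_tendsto (hS t x).norm (Eventually.of_forall fun n => norm_expOp_apply_le (hB n) t.2 x)
  have hS0 : S 0 = ContinuousLinearMap.id ℝ X := ContinuousLinearMap.ext fun x =>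
    tendsto_nhds_unique (hS 0 x) (by simp [expOp_zero])
  have hSadd : ∀ (s t : ℝ≥0) x, S (s + t) x = S s (S t x) := fun s t x => by
    refine tendsto_nhds_unique (hS (s + t) x) ?_
    rw [tendsto_iff_norm_sub_tendsto_zero]
    have h1 := (tendsto_iff_norm_sub_tendsto_zero.1 (hS t x)).add
      (tendsto_iff_norm_sub_tendsto_zero.1 (hS s (S t x)))
    rw [add_zero] at h1
    refine squeeze_zero (fun _ => norm_nonneg _) (fun n => ?_) h1
    rw [NNReal.coe_add, expOp_add]
    have h2 := norm_expOp_apply_le (hB n) s.2 (expOp (B n) t x - S t x)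
    rw [map_sub] at h2
    exact (norm_sub_le_norm_sub_add_norm_sub _ (expOp (B n) s (S t x)) _).trans
      (add_le_add_left h2 _)
  have hSA : ∀ (t : ℝ≥0) (x : A.domain) (y : A.domain),
      ‖S t x - x - (t : ℝ) • A x‖ ≤ t * (2 * ‖A x - y‖ + t * ‖A y‖) := fun t x y => by
    have h1 := (((hS t x).sub_const (x : X)).sub_const ((t : ℝ) • A x)).norm
    have h2 : Tendsto (fun n => (t : ℝ) * (‖B n x - A x‖ + 2 * ‖A x - y‖ + t * ‖B n y‖)) atTop
        (𝓝 (t * (0 + 2 * ‖A x - y‖ + t * ‖A y‖))) :=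
      ((((tendsto_iff_norm_sub_tendsto_zero.1 (hBA x)).add_const _).add
        ((hBA y).norm.const_mul _))).const_mul _
    rw [zero_add] at h2
    exact le_of_tendsto_of_tendsto' h1 h2 fun n => norm_expOp_sub_sub_le (hB n) t.2 _ _ _
  have hS2 : ∀ x, Tendsto (fun t => S t x) (𝓝 0) (𝓝 x) := by
    refine tendsto_self_of_dense hd hS1 fun x hx => ?_
    rw [tendsto_iff_norm_sub_tendsto_zero]
    have h1 : Tendsto (fun t : ℝ≥0 => (t : ℝ) * ‖A ⟨x, hx⟩‖) (𝓝 0) (𝓝 (0 * ‖A ⟨x, hx⟩‖)) :=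
      (NNReal.tendsto_coe.2 tendsto_id).mul_const _
    rw [zero_mul] at h1
    refine squeeze_zero (fun _ => norm_nonneg _) (fun t => ?_) h1
    refine le_of_tendsto_of_tendsto' ((hS t x).sub_const x).norm
      ((hBA ⟨x, hx⟩).norm.const_mul _) fun n => norm_expOp_sub_self_le (hB n) t.2 x
  have hScont : ∀ x, Continuous fun t => S t x := fun x => by
    have key : ∀ s t : ℝ≥0, s ≤ t → ‖S t x - S s x‖ ≤ ‖S (t - s) x - x‖ := fun s t hst => by
      have := hS1 s (S (t - s) x - x)
      rwa [map_sub, ← hSadd, add_tsub_cancel_of_le hst] at this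
    rw [continuous_iff_continuousAt]
    intro s
    have h1 : Tendsto (fun t => ‖S (t - s) x - x‖ + ‖S (s - t) x - x‖) (𝓝 s) (𝓝 (0 + 0)) := by
      have h2 := tendsto_iff_norm_sub_tendsto_zero.1 (hS2 x)
      refine (h2.comp ?_).add (h2.comp ?_)
      · exact ((continuous_id.sub continuous_const).tendsto' s 0 (tsub_self s))
      · exact ((continuous_const.sub continuous_id).tendsto' s 0 (tsub_self s))
    rw [add_zero] at h1
    refine tendsto_iff_norm_sub_tendsto_zero.2 (squeeze_zero (fun _ => norm_nonneg _)
      (fun t => ?_) h1)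
    rcases le_total s t with hst | hst
    · exact (key s t hst).trans (le_add_of_nonneg_right (norm_nonneg _))
    · rw [norm_sub_rev]
      exact (key t s hst).trans (le_add_of_nonneg_left (norm_nonneg _))
  let T : C0Semigroup X := ⟨S, hS0, fun s t => ContinuousLinearMap.ext (hSadd s t), hScont⟩
  have hpos : ∀ᶠ t : ℝ≥0 in 𝓝[>] 0, 0 < t := self_mem_nhdsWithin
  have hgen : A.graph ≤ T.generatorGraph := by
    intro p hp
    obtain ⟨x, hx1, hx2⟩ := LinearPMap.mem_graph_iff _ |>.1 hp
    change Tendsto (fun t : ℝ≥0 => (t : ℝ)⁻¹ • (S t p.1 - p.1)) (𝓝[>] 0) (𝓝 p.2)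
    rw [← hx1, ← hx2, Metric.tendsto_nhds]
    intro ε hε
    -- With `ε / 4` here and `t ‖A y‖ < ε / 2` below, the bound `hSA` divided by `t` is less than
    -- `ε`.
    obtain ⟨y, hy, hxy⟩ := hd.exists_dist_lt (A x) (show 0 < ε / 4 by positivity)
    have h1 : Tendsto (fun t : ℝ≥0 => (t : ℝ) * ‖A ⟨y, hy⟩‖) (𝓝[>] 0) (𝓝 (0 * ‖A ⟨y, hy⟩‖)) :=
      (NNReal.tendsto_coe.2 (tendsto_id.mono_left nhdsWithin_le_nhds)).mul_const _
    rw [zero_mul] at h1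
    filter_upwards [hpos, h1.eventually_lt_const (show 0 < ε / 2 by positivity)] with t ht0 ht
    have ht0' : (0 : ℝ) < t := ht0
    have h2 := hSA t x ⟨y, hy⟩
    have e : S t x - x - (t : ℝ) • A x = (t : ℝ) • ((t : ℝ)⁻¹ • (S t x - x) - A x) := by
      rw [smul_sub, smul_inv_smul₀ ht0'.ne']
    rw [e, norm_smul, Real.norm_eq_abs, abs_of_pos ht0', mul_le_mul_iff_right₀ ht0'] at h2
    rw [dist_eq_norm] at hxy ⊢
    linarith
  refine ⟨T, LinearPMap.eq_of_eq_graph (le_antisymm ?_ ?_), hS1⟩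
  · rw [C0Semigroup.generator_graph]
    rintro ⟨x, y⟩ hxy
    -- The generator of a contraction semigroup is dissipative. Since `c - A` is already onto, `A`
    -- has no proper dissipative extension.
    have hdiss : ∀ p ∈ T.generatorGraph, inner ℝ p.2 p.1 ≤ (0 : ℝ) := by
      intro p hp
      refine le_of_tendsto (Tendsto.inner hp (tendsto_const_nhds (x := p.1))) ?_
      refine Eventually.of_forall fun t => ?_
      rw [real_inner_smul_left, inner_sub_left, real_inner_self_eq_norm_sq]
      refine mul_nonpos_of_nonneg_of_nonpos (by positivity) ?_
      have h1 := real_inner_le_norm (S t p.1) p.1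
      have h2 := mul_le_mul_of_nonneg_right (hS1 t p.1) (norm_nonneg p.1)
      change inner ℝ (S t p.1) p.1 - _ ≤ 0
      nlinarith
    obtain ⟨x', hx'⟩ := hs (c 0) (hc0 0) (c 0 • x - y)
    have h1 : (x, y) - ((x' : X), A x') ∈ T.generatorGraph :=
      sub_mem hxy (hgen (A.mem_graph x'))
    have h2 : y - A x' = c 0 • (x - x') := by
      linear_combination (norm := module) hx'
    have h3 := hdiss _ h1
    simp only [Prod.fst_sub, Prod.snd_sub, h2, real_inner_smul_left,
      real_inner_self_eq_norm_sq] at h3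
    have h4 : ‖x - x'‖ = 0 := by
      have := nonpos_of_mul_nonpos_right h3 (hc 0)
      exact pow_eq_zero_iff two_ne_zero |>.1 (le_antisymm this (sq_nonneg _))
    have h5 := sub_eq_zero.1 (norm_eq_zero.1 h4)
    rw [h5, sub_self, smul_zero, sub_eq_zero] at h2
    rw [h5, h2]
    exact A.mem_graph x'
  · rw [C0Semigroup.generator_graph]
    exact hgen

end HilleYosida

/-! ### A range criterion for self-adjointness. -/

section SelfAdjoint

variable {X : Type*} [NormedAddCommGroup X] [InnerProductSpace ℝ X] [CompleteSpace X]
  {A : X →ₗ.[ℝ] X}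

/-- A symmetric operator `A` with `c - A` onto for some real `c` is self-adjoint. -/
theorem isSelfAdjoint_of_surjective (hd : Dense (A.domain : Set X)) (hA : A.IsFormalAdjoint A)
    {c : ℝ} (hs : ∀ y, ∃ x : A.domain, c • (x : X) - A x = y) : IsSelfAdjoint A := by
  rw [LinearPMap.isSelfAdjoint_def]
  refine (LinearPMap.eq_of_le_of_domain_eq (hA.le_adjoint hd) ?_).symm
  refine le_antisymm (hA.le_adjoint hd).1 fun x hx => ?_
  -- Choose `y` in the domain with `(c - A) y = (c - A*) x`. Then `x - y` is orthogonal to the range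
  -- of `c - A`, which is everything.
  obtain ⟨y, hy⟩ := hs (c • x - A.adjoint ⟨x, hx⟩)
  have h1 : ∀ v : A.domain, inner ℝ (x - y) (c • (v : X) - A v) = (0 : ℝ) := fun v => by
    have h2 := LinearPMap.adjoint_isFormalAdjoint hd ⟨x, hx⟩ v
    have h3 := hA y v
    have h4 : inner ℝ (c • (y : X) - A y) (v : X) =
      inner ℝ (c • x - A.adjoint ⟨x, hx⟩) (v : X) := by rw [hy]
    simp only [inner_sub_left, inner_sub_right, real_inner_smul_left, real_inner_smul_right]
      at h2 h3 h4 ⊢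
    linarith
  obtain ⟨v, hv⟩ := hs (x - y)
  have h2 := h1 v
  rw [hv, inner_self_eq_zero, sub_eq_zero] at h2
  rw [h2]
  exact y.2

end SelfAdjoint

/-! ### Exponential decay of a semigroup from a spectral gap. -/

section Decay

variable {X : Type*} [NormedAddCommGroup X] [InnerProductSpace ℝ X]

/-- A Grönwall inequality for right derivatives, the only ones that the definition of the generator
provides directly. -/
theorem exp_mul_le_of_deriv_right_le {g g' : ℝ → ℝ} {lam : ℝ} (hg : Continuous g)
    (hg' : ∀ s, 0 ≤ s → HasDerivWithinAt g (g' s) (Set.Ici s) s)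
    (h : ∀ s, 0 ≤ s → g' s ≤ -lam * g s) {t : ℝ} (ht : 0 ≤ t) :
    Real.exp (lam * t) * g t ≤ g 0 := by
  have h2 : ∀ s, HasDerivAt (fun s : ℝ => Real.exp (lam * s)) (Real.exp (lam * s) * lam) s :=
    fun s => by simpa using ((hasDerivAt_id s).const_mul lam).exp
  refine image_le_of_deriv_right_le_deriv_boundary (a := 0) (b := t)
    (f := fun s => Real.exp (lam * s) * g s)
    (B := fun _ => g 0) (B' := fun _ => 0) (by fun_prop)
    (fun s hs => (h2 s).hasDerivWithinAt.mul (hg' s hs.1)) (by simp) continuousOn_const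
    (fun s _ => hasDerivWithinAt_const _ _ _) (fun s hs => ?_) ⟨ht, le_rfl⟩
  have := mul_le_mul_of_nonneg_left (h s hs.1) (Real.exp_pos (lam * s)).le
  linarith

theorem C0Semigroup.op_mem_generatorGraph (T : C0Semigroup X) (t : ℝ≥0) {x y : X}
    (h : (x, y) ∈ T.generatorGraph) : (T.op t x, T.op t y) ∈ T.generatorGraph := by
  refine (((T.op t).continuous.tendsto y).comp h).congr fun s => ?_
  have h1 : T.op t (T.op s x) = T.op s (T.op t x) := by
    have := congrArg (fun F : X →L[ℝ] X => F x)
      ((T.op_add t s).symm.trans ((congrArg T.op (add_comm t s)).trans (T.op_add s t)))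
    exact this
  simp only [Function.comp_apply, map_smul, map_sub, h1]

theorem C0Semigroup.hasDerivWithinAt (T : C0Semigroup X) {x y : X} (h : (x, y) ∈ T.generatorGraph)
    {t : ℝ} (ht : 0 ≤ t) :
    HasDerivWithinAt (fun s : ℝ => T.op s.toNNReal x) (T.op t.toNNReal y) (Set.Ici t) t := by
  rw [hasDerivWithinAt_iff_tendsto_slope, Set.Ici_sdiff_left]
  have h1 : Tendsto (fun s : ℝ => (s - t).toNNReal) (𝓝[>] t) (𝓝[>] 0) := by
    refine tendsto_nhdsWithin_iff.2 ⟨?_, ?_⟩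
    · refine Tendsto.mono_left ?_ nhdsWithin_le_nhds
      exact (continuous_real_toNNReal.comp (continuous_id.sub continuous_const)).tendsto' _ _
        (by simp)
    · filter_upwards [self_mem_nhdsWithin] with s hs
      exact Real.toNNReal_pos.2 (sub_pos.2 hs)
  refine (Tendsto.comp (T.op_mem_generatorGraph t.toNNReal h) h1).congr' ?_
  filter_upwards [self_mem_nhdsWithin] with s hs
  have hs' : 0 ≤ s - t := sub_nonneg.2 (le_of_lt hs)
  have h2 : T.op s.toNNReal x = T.op (s - t).toNNReal (T.op t.toNNReal x) := by
    have := T.op_add (s - t).toNNReal t.toNNReal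
    rw [← Real.toNNReal_add hs' ht, sub_add_cancel] at this
    rw [this]; rfl
  simp only [Function.comp_apply, slope, vsub_eq_sub, h2, Real.coe_toNNReal _ hs']

/-- If `e` is in the domain of the generator `A`, the range of `A` is orthogonal to `e`, and `A` has
a spectral gap on the orthogonal complement of `e`, then the semigroup decays exponentially
there. -/
theorem C0Semigroup.norm_op_le_exp_mul {A : X →ₗ.[ℝ] X} {T : C0Semigroup X} (hT : T.generator = A)
    (hd : Dense (A.domain : Set X)) {e : X} (he : e ∈ A.domain)
    (hAe : ∀ x : A.domain, inner ℝ e (A x) = (0 : ℝ)) {lam : ℝ}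
    (hgap : ∀ x : A.domain, inner ℝ e (x : X) = (0 : ℝ) →
      inner ℝ (A x) (x : X) ≤ -lam * ‖(x : X)‖ ^ 2) {x : X} (hx : inner ℝ e x = (0 : ℝ)) (t : ℝ≥0) :
    ‖T.op t x‖ ≤ Real.exp (-lam * t) * ‖x‖ := by
  have key : ∀ x : A.domain, inner ℝ e (x : X) = (0 : ℝ) →
      ‖T.op t x‖ ≤ Real.exp (-lam * t) * ‖(x : X)‖ := by
    intro x hx
    have hxg : ((x : X), A x) ∈ T.generatorGraph := by
      rw [← T.generator_graph, hT]; exact A.mem_graph x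
    have hdom : ∀ s : ℝ, ∃ v : A.domain, (v : X) = T.op s.toNNReal x ∧
        A v = T.op s.toNNReal (A x) := fun s => by
      have := T.op_mem_generatorGraph s.toNNReal hxg
      rw [← T.generator_graph, hT] at this
      exact (LinearPMap.mem_graph_iff _).1 this
    have hc : Continuous fun s : ℝ => T.op s.toNNReal (x : X) :=
      (T.continuous_op x).comp continuous_real_toNNReal
    have horth : ∀ s : ℝ, 0 ≤ s → inner ℝ e (T.op s.toNNReal (x : X)) = (0 : ℝ) := by
      intro s hs
      -- The pairing with `e` is conserved, because its derivative is a pairing of `e` with the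
      -- range of `A`.
      have h1 := constant_of_has_deriv_right_zero (a := 0) (b := s)
        (f := fun s : ℝ => (inner ℝ e (T.op s.toNNReal (x : X)) : ℝ))
        (continuous_const.inner hc).continuousOn (fun r hr => by
          have h2 := (hasDerivWithinAt_const r (Set.Ici r) e).inner ℝ (T.hasDerivWithinAt hxg hr.1)
          obtain ⟨v, -, hv2⟩ := hdom r
          rwa [← hv2, hAe, inner_zero_left, add_zero] at h2) s ⟨hs, le_rfl⟩
      simp only [Real.toNNReal_zero, T.op_zero, ContinuousLinearMap.id_apply, hx] at h1
      exact h1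
    have h1 := exp_mul_le_of_deriv_right_le (lam := 2 * lam)
      (g := fun s : ℝ => ‖T.op s.toNNReal (x : X)‖ ^ 2) (hc.norm.pow 2)
      (fun s hs => (T.hasDerivWithinAt hxg hs).norm_sq) (fun s hs => ?_) t.2
    · simp only [NNReal.val_eq_coe, Real.toNNReal_coe, Real.toNNReal_zero, T.op_zero,
        ContinuousLinearMap.id_apply] at h1
      refine (sq_le_sq₀ (norm_nonneg _) (by positivity)).1 ?_
      have h2 : Real.exp (-lam * t) ^ 2 * Real.exp (2 * lam * t) = 1 := by
        rw [← Real.exp_nat_mul, ← Real.exp_add, Real.exp_eq_one_iff]; push_cast; ring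
      calc ‖T.op t x‖ ^ 2
          = Real.exp (-lam * t) ^ 2 * (Real.exp (2 * lam * t) * ‖T.op t x‖ ^ 2) := by
            rw [← mul_assoc, h2, one_mul]
        _ ≤ Real.exp (-lam * t) ^ 2 * ‖(x : X)‖ ^ 2 := by gcongr
        _ = _ := by ring
    · obtain ⟨v, hv1, hv2⟩ := hdom s
      have h2 := hgap v (by rw [hv1]; exact horth s hs)
      simp only [← hv1, ← hv2]
      rw [real_inner_comm]
      linarith
  -- Projecting onto the complement of `e` keeps the domain invariant, since `e` lies in it, so the
  -- estimate passes from the dense domain to all of `e^⊥`. If `e = 0`, division by zero makes `P`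
  -- the identity, as it should be.
  let P : X → X := fun y => y - (inner ℝ e y / ‖e‖ ^ 2) • e
  have hP : Continuous P := by fun_prop
  have h1 : IsClosed {y | ‖T.op t (P y)‖ ≤ Real.exp (-lam * t) * ‖P y‖} :=
    isClosed_le ((T.op t).continuous.comp hP).norm (hP.norm.const_mul _)
  have h2 : x ∈ {y | ‖T.op t (P y)‖ ≤ Real.exp (-lam * t) * ‖P y‖} := by
    refine h1.closure_subset_iff.2 (fun y hy => ?_) (hd x)
    refine key ⟨P y, sub_mem hy (A.domain.smul_mem _ he)⟩ ?_
    simp only [P, inner_sub_right, real_inner_smul_right, real_inner_self_eq_norm_sq]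
    rcases eq_or_ne e 0 with rfl | h0
    · simp
    · have := norm_ne_zero_iff.2 h0
      field_simp
      ring
  simpa [P, hx] using h2

end Decay

/-! ### Sums over the positive integers -/

theorem summable_succ_iff {f : ℕ+ → ℝ} : (Summable fun i => f (i + 1)) ↔ Summable f := by
  rw [← Equiv.pnatEquivNat.symm.summable_iff (f := f),
    ← Equiv.pnatEquivNat.symm.summable_iff (f := fun i => f (i + 1)), ← summable_nat_add_iff (f := f ∘ Equiv.pnatEquivNat.symm) 1]
  rfl

theorem tsum_eq_add_tsum_succ {f : ℕ+ → ℝ} (hf : Summable f) :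
    ∑' i, f i = f 1 + ∑' i, f (i + 1) := by
  rw [← Equiv.pnatEquivNat.symm.tsum_eq f, ← Equiv.pnatEquivNat.symm.tsum_eq fun i => f (i + 1),
    Summable.tsum_eq_zero_add (f := fun n => f (Equiv.pnatEquivNat.symm n))
      ((Equiv.pnatEquivNat.symm.summable_iff (f := f)).2 hf)]
  rfl

theorem tsum_succ_le {f : ℕ+ → ℝ} (hf : Summable f) (h0 : ∀ i, 0 ≤ f i) :
    ∑' i, f (i + 1) ≤ ∑' i, f i := by
  rw [tsum_eq_add_tsum_succ hf]; linarith [h0 1]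

/-! ### Weighted estimates and the relative bound of the off-diagonal part. -/

namespace Setting

variable {S : Setting}

theorem q_mul_sq_le (h : S.H) (i : ℕ+) : S.q i * h i ^ 2 ≤ ‖h‖ ^ 2 := by
  rw [norm_sq_def]
  exact (summable_sq h).le_tsum i fun j _ => mul_nonneg (S.q_pos j).le (sq_nonneg _)

theorem sq_apply_le (h : S.H) (i : ℕ+) : h i ^ 2 ≤ (S.q i)⁻¹ * ‖h‖ ^ 2 := by
  rw [inv_mul_eq_div, le_div_iff₀ (S.q_pos i), mul_comm]
  exact q_mul_sq_le h i

theorem norm_sq_seq (f : ℕ+ → ℝ) (hf) : ‖S.seq f hf‖ ^ 2 = ∑' i, S.q i * f i ^ 2 := norm_sq_def _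

theorem inner_seq_single (f : S.H) (i : ℕ+) (hh) :
    inner ℝ f (S.seq (Pi.single i 1) hh) = S.q i * f i := by
  rw [inner_def, tsum_eq_single i fun j hj => by simp [Pi.single_eq_of_ne hj]]
  simp

theorem summable_single (i : ℕ+) :
    Summable fun j => S.q j * (Pi.single i 1 : ℕ+ → ℝ) j ^ 2 :=
  summable_of_hasFiniteSupport ((Set.finite_singleton i).subset fun j hj => by
    by_contra hne
    exact hj (by simp [Pi.single_eq_of_ne hne]))

theorem single_mem_l00 (i : ℕ+) : S.seq (Pi.single i 1) (summable_single i) ∈ S.l00 :=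
  ⟨i + 1, fun _ hj => Pi.single_eq_of_ne ((PNat.lt_add_right i 1).trans_le hj).ne' _⟩

theorem dense_l00 : Dense (S.l00 : Set S.H) := by
  rw [Submodule.dense_iff_topologicalClosure_eq_top, Submodule.topologicalClosure_eq_top_iff,
    Submodule.eq_bot_iff]
  intro f hf
  refine H_ext fun i => ?_
  have h1 := Submodule.inner_left_of_mem_orthogonal (single_mem_l00 i) hf
  rw [inner_seq_single] at h1
  exact (mul_eq_zero.1 h1).resolve_left (S.q_pos i).ne'

variable (S)

theorem summable_qa : Summable fun i => S.q i * S.a i ^ 2 := by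
  refine Summable.of_nonneg_of_le (fun i => mul_nonneg (S.q_pos i).le (sq_nonneg _))
    (fun i => ?_) S.summable_ab
  rw [mul_comm]
  refine mul_le_mul_of_nonneg_right (pow_le_pow_left₀ (S.a_pos i).le ?_ 2) (S.q_pos i).le
  linarith [S.b_nonneg i]

theorem summable_qb : Summable fun i => S.q i * S.b i ^ 2 := by
  refine Summable.of_nonneg_of_le (fun i => mul_nonneg (S.q_pos i).le (sq_nonneg _))
    (fun i => ?_) S.summable_ab
  rw [mul_comm]
  refine mul_le_mul_of_nonneg_right (pow_le_pow_left₀ (S.b_nonneg i) ?_ 2) (S.q_pos i).le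
  linarith [S.a_pos i]

/-- The coefficients `a` as an element of `ℋ`. -/
def aH : S.H := S.seq S.a S.summable_qa

/-- The coefficients `b` as an element of `ℋ`. -/
def bH : S.H := S.seq S.b S.summable_qb

variable {S}

/-- Detailed balance rewrites the `h (i + 1)` term with weight `b_{i+1} 𝒬_{i+1}`, so the sum splits
into pairings with `a`, `b` in `ℋ` and a multiple of `h 1`. The shift in `b` loses nothing because
`b 1 = 0`. -/
theorem hasSum_W (h : S.H) :
    HasSum (S.W h) (S.q 1 * inner ℝ S.aH h + (∑' i, S.a i * S.q i) * (S.q 1 * h 1) -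
      inner ℝ S.bH h) := by
  have h1 : HasSum (fun i => S.q 1 * (S.q i * S.aH i * h i)) (S.q 1 * inner ℝ S.aH h) :=
    (summable_mul S.aH h).hasSum.mul_left _
  have h2 := S.summable_aq.hasSum.mul_right (S.q 1 * h 1)
  have h3 : HasSum (fun i => S.q (i + 1) * S.bH (i + 1) * h (i + 1)) (inner ℝ S.bH h) := by
    have hs := summable_mul S.bH h
    have : inner ℝ S.bH h = ∑' i, S.q (i + 1) * S.bH (i + 1) * h (i + 1) := by
      rw [inner_def, tsum_eq_add_tsum_succ hs]
      simp [bH, S.b_one]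
    rw [this]
    exact (summable_succ_iff.2 hs).hasSum
  refine ((h1.add h2).sub h3).congr_fun fun i => ?_
  have := S.detailed_balance i
  simp only [W, aH, bH, seq_apply]
  linear_combination (-h (i + 1)) * this

/-- The first row of the operator is a bounded functional on all of `ℋ`: it involves only `h 1`, `h
2` and the pairings of `hasSum_W`. -/
theorem exists_Lfun_one_bound (S : Setting) : ∃ C, 0 ≤ C ∧ ∀ h : S.H,
    S.q 1 * (S.Lfun h 1 + S.sigma 1 * h 1) ^ 2 ≤ C * ‖h‖ ^ 2 := by
  have hq := S.q_pos 1
  let c1 : ℝ := S.sigma 1 - (1 / S.q 1) * (S.a 1 * S.q 1 * S.q 1 * 2 +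
    (∑' i, S.a i * S.q i) * S.q 1)
  let c2 : ℝ := S.a 1 * S.q 1
  have key : ∀ h : S.H, S.Lfun h 1 + S.sigma 1 * h 1 =
      c1 * h 1 + c2 * h (1 + 1) + (- inner ℝ S.aH h) + (1 / S.q 1) * inner ℝ S.bH h := by
    intro h
    rw [Lfun, if_pos rfl, (hasSum_W h).tsum_eq, W]
    simp only [c1, c2]
    field_simp
    ring
  refine ⟨S.q 1 * (4 * (c1 ^ 2 * (S.q 1)⁻¹ + c2 ^ 2 * (S.q (1 + 1))⁻¹ + ‖S.aH‖ ^ 2 +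
    (1 / S.q 1) ^ 2 * ‖S.bH‖ ^ 2)), ?_, fun h => ?_⟩
  · have := S.q_pos (1 + 1)
    positivity
  · rw [key, mul_assoc (S.q 1) (4 * _)]
    refine mul_le_mul_of_nonneg_left ?_ hq.le
    have h1 := mul_le_mul_of_nonneg_left (sq_apply_le h 1) (sq_nonneg c1)
    have h2 := mul_le_mul_of_nonneg_left (sq_apply_le h (1 + 1)) (sq_nonneg c2)
    have h3 : (inner ℝ S.aH h : ℝ) ^ 2 ≤ ‖S.aH‖ ^ 2 * ‖h‖ ^ 2 := by
      rw [← mul_pow, sq_le_sq, abs_of_nonneg (a := ‖S.aH‖ * ‖h‖) (by positivity)]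
      exact abs_real_inner_le_norm _ _
    have h4 : (inner ℝ S.bH h : ℝ) ^ 2 ≤ ‖S.bH‖ ^ 2 * ‖h‖ ^ 2 := by
      rw [← mul_pow, sq_le_sq, abs_of_nonneg (a := ‖S.bH‖ * ‖h‖) (by positivity)]
      exact abs_real_inner_le_norm _ _
    have h5 := mul_le_mul_of_nonneg_left h4 (sq_nonneg (1 / S.q 1))
    have h6 : ∀ x y u v : ℝ, (x + y + u + v) ^ 2 ≤ 4 * (x ^ 2 + y ^ 2 + u ^ 2 + v ^ 2) := by
      intro x y u v
      linarith [sq_nonneg (x - y), sq_nonneg (x - u), sq_nonneg (x - v), sq_nonneg (y - u),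
        sq_nonneg (y - v), sq_nonneg (u - v)]
    refine (h6 _ _ _ _).trans ?_
    simp only [mul_pow, neg_sq]
    linarith

theorem sigma_succ (S : Setting) (i : ℕ+) :
    S.sigma (i + 1) = S.a (i + 1) * S.q 1 + S.b (i + 1) := by
  rw [sigma, if_neg (PNat.lt_add_left 1 i).ne']

theorem a_mul_le_sigma (S : Setting) (i : ℕ+) : S.a i * S.q 1 ≤ S.sigma i := by
  induction i using PNat.recOn with
  | one =>
    rw [sigma, if_pos rfl]
    have h1 := mul_pos (S.a_pos 1) (S.q_pos 1)
    have : 0 ≤ ∑' k, S.a k * S.q k := tsum_nonneg fun i => (mul_pos (S.a_pos i) (S.q_pos i)).le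
    linarith
  | succ n _ => rw [sigma_succ]; linarith [S.b_nonneg (n + 1)]

theorem sigma_pos (S : Setting) (i : ℕ+) : 0 < S.sigma i :=
  (mul_pos (S.a_pos i) (S.q_pos 1)).trans_le (S.a_mul_le_sigma i)

theorem b_le_sigma (S : Setting) (i : ℕ+) : S.b i ≤ S.sigma i := by
  induction i using PNat.recOn with
  | one => rw [S.b_one]; exact (S.sigma_pos 1).le
  | succ n _ => rw [sigma_succ]; linarith [mul_pos (S.a_pos (n + 1)) (S.q_pos 1)]

theorem Lfun_succ (S : Setting) (h : ℕ+ → ℝ) (j : ℕ+) :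
    S.Lfun h (j + 1) = S.b (j + 1) * (h j + h 1 - h (j + 1)) -
      S.a (j + 1) * S.q 1 * (h (j + 1) + h 1 - h (j + 1 + 1)) := by
  have hq := (S.q_pos (j + 1)).ne'
  rw [Lfun, if_neg (PNat.lt_add_left 1 j).ne', PNat.add_sub, W, W, S.detailed_balance j]
  field_simp

theorem Lfun_succ_add_sigma (S : Setting) (h : ℕ+ → ℝ) (j : ℕ+) :
    S.Lfun h (j + 1) + S.sigma (j + 1) * h (j + 1) =
      S.b (j + 1) * h j + S.a (j + 1) * S.q 1 * h (j + 1 + 1) +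
        (S.b (j + 1) - S.a (j + 1) * S.q 1) * h 1 := by
  rw [Lfun_succ, sigma_succ]; ring

/-- The product of the two off-diagonal entries of the linearized operator is at most `κ σ²`, up to
a constant. -/
structure OffDiagBound (S : Setting) (κ C : ℝ) : Prop where
  nonneg : 0 ≤ κ
  const_nonneg : 0 ≤ C
  lower : ∀ j, S.a j * S.q 1 * S.b (j + 1) ≤ κ * S.sigma j ^ 2 + C
  upper : ∀ j, S.a j * S.q 1 * S.b (j + 1) ≤ κ * S.sigma (j + 1) ^ 2 + C

theorem summable_sigma_sq {h : S.H} (hh : h ∈ S.H2) :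
    Summable fun i => S.q i * S.sigma i ^ 2 * h i ^ 2 := by
  refine (Summable.sub hh (summable_sq h)).congr fun i => by ring

theorem hasSum_weight {h : S.H} (hh : h ∈ S.H2) (κ C : ℝ) :
    HasSum (fun i => S.q i * (κ * S.sigma i ^ 2 + C) * h i ^ 2)
      (κ * ∑' i, S.q i * S.sigma i ^ 2 * h i ^ 2 + C * ‖h‖ ^ 2) := by
  rw [norm_sq_def]
  refine (((summable_sigma_sq hh).hasSum.mul_left κ).add
    ((summable_sq h).hasSum.mul_left C)).congr_fun fun i => by ring

/-- Here and in `q_a_sq`, detailed balance moves the weight across one index, so the same product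
controls the subdiagonal and the superdiagonal. -/
theorem q_b_sq (S : Setting) (j : ℕ+) :
    S.q (j + 1) * S.b (j + 1) ^ 2 = S.q j * (S.a j * S.q 1 * S.b (j + 1)) := by
  linear_combination (-S.b (j + 1)) * S.detailed_balance j

theorem q_a_sq (S : Setting) (j : ℕ+) :
    S.q j * (S.a j * S.q 1) ^ 2 = S.q (j + 1) * (S.a j * S.q 1 * S.b (j + 1)) := by
  linear_combination (S.a j * S.q 1) * S.detailed_balance j

theorem q_b_sq_le {κ C : ℝ} (hS : S.OffDiagBound κ C) (h : ℕ+ → ℝ) (j : ℕ+) :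
    S.q (j + 1) * S.b (j + 1) ^ 2 * h j ^ 2 ≤ S.q j * (κ * S.sigma j ^ 2 + C) * h j ^ 2 := by
  rw [q_b_sq]
  exact mul_le_mul_of_nonneg_right (mul_le_mul_of_nonneg_left (hS.lower j) (S.q_pos j).le)
    (sq_nonneg _)

theorem q_a_sq_le {κ C : ℝ} (hS : S.OffDiagBound κ C) (h : ℕ+ → ℝ) (j : ℕ+) :
    S.q j * (S.a j * S.q 1) ^ 2 * h (j + 1) ^ 2 ≤
      S.q (j + 1) * (κ * S.sigma (j + 1) ^ 2 + C) * h (j + 1) ^ 2 := by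
  rw [q_a_sq]
  exact mul_le_mul_of_nonneg_right
    (mul_le_mul_of_nonneg_left (hS.upper j) (S.q_pos (j + 1)).le) (sq_nonneg _)

theorem summable_q_b_sub (S : Setting) :
    Summable fun i => S.q i * (S.b i - S.a i * S.q 1) ^ 2 := by
  refine Summable.of_nonneg_of_le (fun i => mul_nonneg (S.q_pos i).le (sq_nonneg _))
    (fun i => ?_) ((S.summable_qb.mul_left 2).add (S.summable_qa.mul_left (2 * S.q 1 ^ 2)))
  have := mul_nonneg (S.q_pos i).le (sq_nonneg (S.b i + S.a i * S.q 1))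
  linarith

/-- The off-diagonal part of the linearized operator is bounded relative to the diagonal part, with
relative bound less than one. -/
theorem exists_offDiag_bound {κ C : ℝ} (hS : S.OffDiagBound κ C) (hκ : κ < 1 / 4) :
    ∃ θ C' : ℝ, 0 ≤ θ ∧ θ < 1 ∧ 0 ≤ C' ∧ ∀ h ∈ S.H2,
      (Summable fun i => S.q i * (S.Lfun h i + S.sigma i * h i) ^ 2) ∧
      ∑' i, S.q i * (S.Lfun h i + S.sigma i * h i) ^ 2 ≤
        θ * ∑' i, S.q i * S.sigma i ^ 2 * h i ^ 2 + C' * ‖h‖ ^ 2 := by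
  obtain ⟨C₁, hC₁, hL1⟩ := S.exists_Lfun_one_bound
  have hκ0 := hS.nonneg
  have hC0 := hS.const_nonneg
  have hε : 0 < 1 - 4 * κ := by linarith
  -- With this choice `θ = 4 (1 + ε) κ = (1 + ε)(1 - ε) = 1 - ε² < 1`. The factor `1 + ε` is the
  -- price in Young's inequality for splitting off the `h 1` column, which then carries `1 + ε⁻¹`.
  set ε := 1 - 4 * κ with hε_def
  let D : ℝ := ∑' i, S.q i * (S.b i - S.a i * S.q 1) ^ 2
  have hD : 0 ≤ D := tsum_nonneg fun i => mul_nonneg (S.q_pos i).le (sq_nonneg _)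
  have hq1 := S.q_pos 1
  refine ⟨4 * (1 + ε) * κ, 4 * (1 + ε) * C + (1 + ε⁻¹) * D * (S.q 1)⁻¹ + C₁, by positivity,
    ?_, by positivity, fun h hh => ?_⟩
  · have : 4 * (1 + ε) * κ = 1 - ε ^ 2 := by rw [hε_def]; ring
    rw [this]; linarith [pow_pos hε 2]
  let G : ℕ+ → ℝ := fun i => S.q i * (κ * S.sigma i ^ 2 + C) * h i ^ 2
  have hG := hasSum_weight hh κ C
  have hG0 : ∀ i, 0 ≤ G i := fun i => by
    have := S.q_pos i
    positivity
  have hGs : Summable G := hG.summable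
  have hG1 : Summable fun i => G (i + 1) := summable_succ_iff.2 hGs
  have hG2 : Summable fun i => G (i + 1 + 1) :=
    summable_succ_iff (f := fun i => G (i + 1)) |>.2 hG1
  have hDs : Summable fun i => S.q (i + 1) * (S.b (i + 1) - S.a (i + 1) * S.q 1) ^ 2 :=
    summable_succ_iff (f := fun i => S.q i * (S.b i - S.a i * S.q 1) ^ 2) |>.2 S.summable_q_b_sub
  have hpt : ∀ j, S.q (j + 1) * (S.Lfun h (j + 1) + S.sigma (j + 1) * h (j + 1)) ^ 2 ≤
      2 * (1 + ε) * (G j + G (j + 1 + 1)) +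
        (1 + ε⁻¹) * h 1 ^ 2 * (S.q (j + 1) * (S.b (j + 1) - S.a (j + 1) * S.q 1) ^ 2) := by
    intro j
    rw [Lfun_succ_add_sigma]
    have h1 := q_b_sq_le hS h j
    have h2 := q_a_sq_le hS h (j + 1)
    have hy : ∀ x y k : ℝ, (x + y + k) ^ 2 ≤ 2 * (1 + ε) * (x ^ 2 + y ^ 2) + (1 + ε⁻¹) * k ^ 2 := by
      intro x y k
      have e1 : 0 ≤ ε * (x + y - ε⁻¹ * k) ^ 2 := by positivity
      have e2 : ε * (x + y - ε⁻¹ * k) ^ 2 = ε * (x + y) ^ 2 - 2 * (x + y) * k + ε⁻¹ * k ^ 2 := by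
        field_simp
        ring
      have e3 : 0 ≤ (1 + ε) * (x - y) ^ 2 := by positivity
      linarith
    have h3 := mul_le_mul_of_nonneg_left (hy (S.b (j + 1) * h j)
      (S.a (j + 1) * S.q 1 * h (j + 1 + 1)) ((S.b (j + 1) - S.a (j + 1) * S.q 1) * h 1))
      (S.q_pos (j + 1)).le
    have h4 := mul_le_mul_of_nonneg_left (add_le_add h1 h2)
      (show 0 ≤ 2 * (1 + ε) by positivity)
    refine h3.trans ?_
    simp only [G]
    linarith
  have hRs := ((hGs.add hG2).mul_left (2 * (1 + ε))).add (hDs.mul_left ((1 + ε⁻¹) * h 1 ^ 2))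
  have hs : Summable fun j => S.q (j + 1) * (S.Lfun h (j + 1) + S.sigma (j + 1) * h (j + 1)) ^ 2 :=
    Summable.of_nonneg_of_le (fun j => mul_nonneg (S.q_pos _).le (sq_nonneg _)) hpt hRs
  have hs' : Summable fun i => S.q i * (S.Lfun h i + S.sigma i * h i) ^ 2 := summable_succ_iff.1 hs
  refine ⟨hs', ?_⟩
  rw [tsum_eq_add_tsum_succ hs']
  have h1 := hs.tsum_le_tsum hpt hRs
  rw [((hGs.add hG2).mul_left _).tsum_add (hDs.mul_left _), tsum_mul_left, tsum_mul_left,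
    hGs.tsum_add hG2] at h1
  have h2 : ∑' i, G (i + 1 + 1) ≤ ∑' i, G i :=
    (tsum_succ_le (f := fun i => G (i + 1)) hG1 fun i => hG0 _).trans (tsum_succ_le hGs hG0)
  have h3 : ∑' i, S.q (i + 1) * (S.b (i + 1) - S.a (i + 1) * S.q 1) ^ 2 ≤ D :=
    tsum_succ_le (f := fun i => S.q i * (S.b i - S.a i * S.q 1) ^ 2) S.summable_q_b_sub
      fun i => mul_nonneg (S.q_pos _).le (sq_nonneg _)
  have h4 : (1 + ε⁻¹) * h 1 ^ 2 * ∑' i, S.q (i + 1) * (S.b (i + 1) - S.a (i + 1) * S.q 1) ^ 2 ≤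
      (1 + ε⁻¹) * ((S.q 1)⁻¹ * ‖h‖ ^ 2) * D :=
    mul_le_mul (mul_le_mul_of_nonneg_left (sq_apply_le h 1) (by positivity)) h3
      (tsum_nonneg fun i => mul_nonneg (S.q_pos _).le (sq_nonneg _)) (by positivity)
  have h5 := mul_le_mul_of_nonneg_left h2 (show 0 ≤ 2 * (1 + ε) by positivity)
  have h6 : ∑' i, G i = _ := hG.tsum_eq
  have h7 := hL1 h
  rw [h6] at h1 h5
  linarith


/-! ### Integration by parts -/

theorem sq_add_sub_le (x y z : ℝ) : (x + y - z) ^ 2 ≤ 3 * (x ^ 2 + y ^ 2 + z ^ 2) := by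
  linarith [sq_nonneg (x - y), sq_nonneg (x + z), sq_nonneg (y + z)]

theorem summable_W_mul {κ C : ℝ} (hS : S.OffDiagBound κ C) {h : S.H} (hh : h ∈ S.H2) (g : S.H) :
    Summable fun i => S.W h i * g i := by
  have h1 : Summable fun i => S.q i * (S.a i * S.q 1 * (h i + h 1 - h (i + 1))) ^ 2 := by
    have e1 := summable_sigma_sq hh
    have e2 := S.summable_qa.mul_right (S.q 1 ^ 2 * h 1 ^ 2)
    have e3 := summable_succ_iff.2 (hasSum_weight hh κ C).summable
    refine Summable.of_nonneg_of_le (fun i => mul_nonneg (S.q_pos i).le (sq_nonneg _))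
      (fun i => ?_) (((e1.add e2).add e3).mul_left 3)
    have f1 : S.q i * (S.a i * S.q 1) ^ 2 * h i ^ 2 ≤ S.q i * S.sigma i ^ 2 * h i ^ 2 := by
      have := mul_pos (S.a_pos i) (S.q_pos 1)
      have := S.a_mul_le_sigma i
      have := S.q_pos i
      gcongr
    have f2 := q_a_sq_le hS h i
    have f3 := mul_le_mul_of_nonneg_left (sq_add_sub_le (h i) (h 1) (h (i + 1)))
      (mul_nonneg (S.q_pos i).le (sq_nonneg (S.a i * S.q 1)))
    linarith
  refine (summable_of_sq (fun i => (S.q_pos i).le) h1 (summable_sq g)).congr fun i => ?_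
  simp only [W]; ring

/-- The shifted factor `g (i + 1)` needs the weight `𝒬_{i+1}`, supplied by writing `a_i 𝒬_i 𝒬_1` as
`b_{i+1} 𝒬_{i+1}`. -/
theorem summable_W_mul_succ {κ C : ℝ} (hS : S.OffDiagBound κ C) {h : S.H} (hh : h ∈ S.H2)
    (g : S.H) : Summable fun i => S.W h i * g (i + 1) := by
  have h1 : Summable fun i => S.q (i + 1) * (S.b (i + 1) * (h i + h 1 - h (i + 1))) ^ 2 := by
    have e1 : Summable fun i => S.q (i + 1) * S.sigma (i + 1) ^ 2 * h (i + 1) ^ 2 :=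
      summable_succ_iff (f := fun i => S.q i * S.sigma i ^ 2 * h i ^ 2) |>.2 (summable_sigma_sq hh)
    have e2 : Summable fun i => S.q (i + 1) * S.b (i + 1) ^ 2 * h 1 ^ 2 :=
      (summable_succ_iff (f := fun i => S.q i * S.b i ^ 2) |>.2 S.summable_qb).mul_right (h 1 ^ 2)
    have e3 := (hasSum_weight hh κ C).summable
    refine Summable.of_nonneg_of_le (fun i => mul_nonneg (S.q_pos _).le (sq_nonneg _))
      (fun i => ?_) (((e3.add e2).add e1).mul_left 3)
    have f1 : S.q (i + 1) * S.b (i + 1) ^ 2 * h (i + 1) ^ 2 ≤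
        S.q (i + 1) * S.sigma (i + 1) ^ 2 * h (i + 1) ^ 2 := by
      have := S.b_nonneg (i + 1)
      have := S.b_le_sigma (i + 1)
      have := S.q_pos (i + 1)
      gcongr
    have f2 := q_b_sq_le hS h i
    have f3 := mul_le_mul_of_nonneg_left (sq_add_sub_le (h i) (h 1) (h (i + 1)))
      (mul_nonneg (S.q_pos (i + 1)).le (sq_nonneg (S.b (i + 1))))
    linarith
  have h2 : Summable fun i => S.q (i + 1) * g (i + 1) ^ 2 :=
    summable_succ_iff (f := fun i => S.q i * g i ^ 2) |>.2 (summable_sq g)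
  refine (summable_of_sq (fun i => (S.q_pos (i + 1)).le) h1 h2).congr fun i => ?_
  simp only [W, S.detailed_balance]; ring

theorem mem_formDomain_of_mem_H2 {κ C : ℝ} (hS : S.OffDiagBound κ C) {h : S.H} (hh : h ∈ S.H2) :
    h ∈ S.formDomain := by
  refine (((summable_W_mul hS hh h).add ((hasSum_W h).summable.mul_right (h 1))).sub
    (summable_W_mul_succ hS hh h)).congr fun i => ?_
  simp only [W]; ring

/-- Summation by parts. The pieces of `W_i (g_i + g_1 - g_{i+1})` are separately summable, so no
boundary term at infinity appears. In the first row, `∑ W` accounts for the `g_1` terms and the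
extra `W_1` for the index lost in the shift. -/
theorem mem_formGraph_of_mem_H2 {κ C : ℝ} (hS : S.OffDiagBound κ C) {h f : S.H} (hh : h ∈ S.H2)
    (hf : ∀ i, f i = S.Lfun h i) : (h, f) ∈ S.formGraph := by
  refine ⟨mem_formDomain_of_mem_H2 hS hh, fun g _ => ?_⟩
  have h1 := summable_W_mul hS hh g
  have h2 := summable_W_mul_succ hS hh g
  have h3 := (hasSum_W h).summable
  have h4 : S.form h g = ∑' i, S.W h i * g i + (∑' i, S.W h i) * g 1 -
      ∑' i, S.W h i * g (i + 1) := by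
    rw [← tsum_mul_right, ← h1.tsum_add (h3.mul_right _), ← (h1.add (h3.mul_right _)).tsum_sub h2]
    refine tsum_congr fun i => ?_
    simp only [W]; ring
  have h5 : inner ℝ f g = S.q 1 * f 1 * g 1 + ∑' i, S.q (i + 1) * f (i + 1) * g (i + 1) := by
    rw [inner_def, tsum_eq_add_tsum_succ (summable_mul f g)]
  have h6 : ∑' i, S.q (i + 1) * f (i + 1) * g (i + 1) =
      ∑' i, S.W h i * g (i + 1) - ∑' i, S.W h (i + 1) * g (i + 1) := by
    rw [← h2.tsum_sub (summable_succ_iff (f := fun i => S.W h i * g i) |>.2 h1)]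
    refine tsum_congr fun i => ?_
    have hq := (S.q_pos (i + 1)).ne'
    rw [hf, Lfun, if_neg (PNat.lt_add_left 1 i).ne', PNat.add_sub]
    field_simp
  have h7 := tsum_eq_add_tsum_succ h1
  have h8 : S.q 1 * f 1 = -(S.W h 1 + ∑' k, S.W h k) := by
    have hq := (S.q_pos 1).ne'
    rw [hf, Lfun, if_pos rfl]
    field_simp
  rw [h4, h5, h6, h8]
  linear_combination h7

/-! ### Symmetry and dissipativity of the form operator. -/

theorem form_comm (h g : S.H) : S.form h g = S.form g h := tsum_congr fun i => by ring

theorem form_self_nonneg (h : S.H) : 0 ≤ S.form h h := tsum_nonneg fun i => by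
  rw [mul_assoc]
  exact mul_nonneg (mul_pos (mul_pos (S.a_pos i) (S.q_pos i)) (S.q_pos 1)).le (mul_self_nonneg _)

theorem formOperator_mem_formGraph (x : S.formOperator.domain) :
    ((x : S.H), S.formOperator x) ∈ S.formGraph := by
  rw [← formOperator_graph]; exact S.formOperator.mem_graph x

theorem mem_formGraph_iff {h f : S.H} :
    (h, f) ∈ S.formGraph ↔ ∃ x : S.formOperator.domain, (x : S.H) = h ∧ S.formOperator x = f := by
  rw [← formOperator_graph]; exact LinearPMap.mem_graph_iff _

theorem inner_formOperator_self (x : S.formOperator.domain) :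
    inner ℝ (S.formOperator x) (x : S.H) = -S.form x x := by
  have h1 := formOperator_mem_formGraph x
  rw [h1.2 _ h1.1, neg_neg]

theorem formOperator_dissipative (x : S.formOperator.domain) :
    inner ℝ (S.formOperator x) (x : S.H) ≤ 0 := by
  rw [inner_formOperator_self, neg_nonpos]
  exact form_self_nonneg _

theorem formOperator_isFormalAdjoint : S.formOperator.IsFormalAdjoint S.formOperator := by
  intro x y
  have h1 := formOperator_mem_formGraph x
  have h2 := formOperator_mem_formGraph y
  have h3 := h1.2 _ h2.1
  have h4 := h2.2 _ h1.1
  rw [form_comm] at h4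
  rw [real_inner_comm (S.formOperator y)]
  linarith

/-! ### Resolvents -/

theorem Lfun_add (f g : S.H) (i : ℕ+) : S.Lfun (f + g : S.H) i = S.Lfun f i + S.Lfun g i := by
  have e : ∀ k, S.W (f + g : S.H) k = S.W f k + S.W g k := W_add f.1 g.1
  have := (hasSum_W f).summable.tsum_add (hasSum_W g).summable
  simp only [Lfun, e, this]
  split_ifs <;> ring

theorem Lfun_smul (c : ℝ) (f : S.H) (i : ℕ+) : S.Lfun (c • f : S.H) i = c * S.Lfun f i := by
  have e : ∀ k, S.W (c • f : S.H) k = c * S.W f k := W_smul c f.1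
  simp only [Lfun, e, tsum_mul_left]
  split_ifs <;> ring

theorem exists_diagResolvent (S : Setting) {c : ℝ} (hc : 0 < c) :
    ∃ D : S.H →L[ℝ] S.H, (∀ g i, D g i = g i / (S.sigma i + c)) ∧ ∀ g, D g ∈ S.H2 ∧
      c ^ 2 * ‖D g‖ ^ 2 ≤ ‖g‖ ^ 2 ∧ ∑' i, S.q i * S.sigma i ^ 2 * D g i ^ 2 ≤ ‖g‖ ^ 2 := by
  have hpos : ∀ i, 0 < S.sigma i + c := fun i => add_pos (S.sigma_pos i) hc
  have hle : ∀ (g : S.H) (i : ℕ+) (r : ℝ), 0 ≤ r → r ≤ S.sigma i + c →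
      r ^ 2 * (S.q i * (g i / (S.sigma i + c)) ^ 2) ≤ S.q i * g i ^ 2 := by
    intro g i r hr hrc
    have h1 : (r / (S.sigma i + c)) ^ 2 ≤ 1 :=
      pow_le_one₀ (div_nonneg hr (hpos i).le) ((div_le_one (hpos i)).2 hrc)
    have h2 := mul_le_mul_of_nonneg_right h1 (mul_nonneg (S.q_pos i).le (sq_nonneg (g i)))
    calc _ = (r / (S.sigma i + c)) ^ 2 * (S.q i * g i ^ 2) := by ring
      _ ≤ _ := by rwa [one_mul] at h2
  have h0 : ∀ (g : S.H) i, 0 ≤ S.q i * (g i / (S.sigma i + c)) ^ 2 := fun g i =>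
    mul_nonneg (S.q_pos i).le (sq_nonneg _)
  have hc1 : ∀ (g : S.H) i, c ^ 2 * (S.q i * (g i / (S.sigma i + c)) ^ 2) ≤ S.q i * g i ^ 2 :=
    fun g i => hle g i c hc.le (le_add_of_nonneg_left (S.sigma_pos i).le)
  have hσ1 : ∀ (g : S.H) i, S.q i * S.sigma i ^ 2 * (g i / (S.sigma i + c)) ^ 2 ≤ S.q i * g i ^ 2 :=
    fun g i => by
      refine Eq.trans_le ?_ (hle g i _ (S.sigma_pos i).le (le_add_of_nonneg_right hc.le))
      ring
  have hcs : ∀ g : S.H, Summable fun i => c ^ 2 * (S.q i * (g i / (S.sigma i + c)) ^ 2) := fun g =>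
    Summable.of_nonneg_of_le (fun i => mul_nonneg (sq_nonneg _) (h0 g i)) (hc1 g) (summable_sq g)
  have hσs : ∀ g : S.H, Summable fun i => S.q i * S.sigma i ^ 2 * (g i / (S.sigma i + c)) ^ 2 :=
    fun g => Summable.of_nonneg_of_le
      (fun i => mul_nonneg (mul_nonneg (S.q_pos i).le (sq_nonneg _)) (sq_nonneg _))
      (hσ1 g) (summable_sq g)
  have hs : ∀ g : S.H, Summable fun i => S.q i * (g i / (S.sigma i + c)) ^ 2 := fun g =>
    (summable_mul_left_iff (pow_pos hc 2).ne').1 (hcs g)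
  let D₀ : S.H →ₗ[ℝ] S.H :=
    { toFun := fun g => S.seq (fun i => g i / (S.sigma i + c)) (hs g)
      map_add' := fun f g => H_ext fun i => add_div _ _ _
      map_smul' := fun k g => H_ext fun i => mul_div_assoc _ _ _ }
  have hn : ∀ g, c ^ 2 * ‖D₀ g‖ ^ 2 ≤ ‖g‖ ^ 2 := fun g => by
    rw [norm_sq_def, norm_sq_def, ← tsum_mul_left]
    exact (hcs g).tsum_le_tsum (hc1 g) (summable_sq g)
  refine ⟨D₀.mkContinuous c⁻¹ fun g => ?_, fun _ _ => rfl, fun g => ⟨?_, hn g, ?_⟩⟩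
  · rw [inv_mul_eq_div, le_div_iff₀ hc, mul_comm]
    exact (sq_le_sq₀ (by positivity) (norm_nonneg _)).1 (by rw [mul_pow]; exact hn g)
  · exact ((hs g).add (hσs g)).congr fun i => by
      change _ = S.q i * (1 + S.sigma i ^ 2) * (g i / (S.sigma i + c)) ^ 2
      ring
  · rw [norm_sq_def]
    exact (hσs g).tsum_le_tsum (hσ1 g) (summable_sq g)

/-- For large `c` the resolvent of the diagonal part parametrizes the graph of the linearized
operator: with `h = D g`, `c h - 𝐋 h = g - K g`, where `1 - K` is onto. -/
theorem exists_parametrization {κ C : ℝ} (hS : S.OffDiagBound κ C) (hκ : κ < 1 / 4) :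
    ∃ c₀ : ℝ, 0 ≤ c₀ ∧ ∀ c, c₀ < c → ∃ D K : S.H →L[ℝ] S.H,
      (∀ y, ∃ g, g - K g = y) ∧ (∀ g i, D g i = g i / (S.sigma i + c)) ∧
      (∀ g, D g ∈ S.H2) ∧ ∀ g i, (c • D g - (g - K g)) i = S.Lfun (D g) i := by
  obtain ⟨θ, C', hθ0, hθ1, hC', hB⟩ := exists_offDiag_bound hS hκ
  have hθ : 0 < 1 - θ := sub_pos.2 hθ1
  refine ⟨1 + C' / (1 - θ), by positivity, fun c hc => ?_⟩
  have hc1 : 1 < c := lt_of_le_of_lt (le_add_of_nonneg_right (by positivity)) hc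
  have hc0 : 0 < c := one_pos.trans hc1
  obtain ⟨D, hD, hD2⟩ := S.exists_diagResolvent hc0
  let K₀ : S.H →ₗ[ℝ] S.H :=
    { toFun := fun g => S.seq (fun i => S.Lfun (D g) i + S.sigma i * D g i) (hB _ (hD2 g).1).1
      map_add' := fun f g => H_ext fun i => by
        simp only [seq_apply, add_apply, map_add, Lfun_add]; ring
      map_smul' := fun k g => H_ext fun i => by
        simp only [seq_apply, smul_apply, map_smul, Lfun_smul, RingHom.id_apply]; ring }
  -- Inserting `‖σ D g‖ ≤ ‖g‖` and `‖D g‖ ≤ ‖g‖ / c` in the relative bound gives `‖K g‖² ≤ ρ ‖g‖²`.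
  -- The threshold on `c` ensures `c² > c > C' / (1 - θ)`, hence `ρ < 1`.
  let ρ : ℝ := θ + C' / c ^ 2
  have hρ0 : 0 ≤ ρ := by positivity
  have hρ : ρ < 1 := by
    have h1 : C' < c ^ 2 * (1 - θ) := by
      have h2 : C' / (1 - θ) < c ^ 2 := by nlinarith
      rwa [div_lt_iff₀ hθ] at h2
    have h3 : C' / c ^ 2 < 1 - θ := by
      rw [div_lt_iff₀ (by positivity), mul_comm]; exact h1
    simp only [ρ]; linarith
  have hK : ∀ g, ‖K₀ g‖ ≤ √ρ * ‖g‖ := fun g => by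
    refine (sq_le_sq₀ (norm_nonneg _) (by positivity)).1 ?_
    rw [mul_pow, Real.sq_sqrt hρ0]
    have h1 : ‖K₀ g‖ ^ 2 = _ := norm_sq_seq _ (hB _ (hD2 g).1).1
    have h2 := (hB _ (hD2 g).1).2
    have h3 := mul_le_mul_of_nonneg_left (hD2 g).2.2 hθ0
    have h4 : ‖D g‖ ^ 2 ≤ ‖g‖ ^ 2 / c ^ 2 := by
      rw [le_div_iff₀ (by positivity), mul_comm]; exact (hD2 g).2.1
    have h5 := mul_le_mul_of_nonneg_left h4 hC'
    rw [h1]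
    refine h2.trans ((add_le_add h3 h5).trans_eq ?_)
    simp only [ρ]; ring
  let K : S.H →L[ℝ] S.H := K₀.mkContinuous (√ρ) hK
  have hK1 : ‖K‖ < 1 := (LinearMap.mkContinuous_norm_le _ (Real.sqrt_nonneg _) _).trans_lt
    ((Real.sqrt_lt' one_pos).2 (by simpa using hρ))
  refine ⟨D, K, fun y => ?_, hD, fun g => (hD2 g).1, fun g i => ?_⟩
  · obtain ⟨u, hu⟩ := isUnit_one_sub_of_norm_lt_one (x := K) hK1
    refine ⟨(u⁻¹ : (S.H →L[ℝ] S.H)ˣ).1 y, ?_⟩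
    have h1 := congrArg (fun F : S.H →L[ℝ] S.H => F y) u.mul_inv
    have h2 := congrArg (fun F : S.H →L[ℝ] S.H => F ((u⁻¹ : (S.H →L[ℝ] S.H)ˣ).1 y)) hu
    exact h2.symm.trans h1
  · have h1 : K g i = S.Lfun (D g) i + S.sigma i * D g i := rfl
    have h2 : (S.sigma i + c) * D g i = g i := by
      rw [hD]; exact mul_div_cancel₀ _ (add_pos (S.sigma_pos i) hc0).ne'
    simp only [sub_apply, smul_apply, h1]
    linear_combination h2

/-! ### Identification of the operators -/

theorem formOperator_surjective {κ C : ℝ} (hS : S.OffDiagBound κ C) (hκ : κ < 1 / 4) :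
    ∃ c₀ : ℝ, 0 ≤ c₀ ∧ ∀ c, c₀ < c → ∀ y, ∃ x : S.formOperator.domain,
      c • (x : S.H) - S.formOperator x = y := by
  obtain ⟨c₀, hc₀, h⟩ := exists_parametrization hS hκ
  refine ⟨c₀, hc₀, fun c hc y => ?_⟩
  obtain ⟨D, K, hsurj, -, hD2, hL⟩ := h c hc
  obtain ⟨g, rfl⟩ := hsurj y
  obtain ⟨x, hx1, hx2⟩ := mem_formGraph_iff.1 (mem_formGraph_of_mem_H2 hS (hD2 g) (hL g))
  exact ⟨x, by rw [hx1, hx2]; abel⟩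

theorem mem_H2_of_mem_l00 {h : S.H} (hh : h ∈ S.l00) : h ∈ S.H2 := by
  obtain ⟨N, hN⟩ := hh
  have hfin : {i | ¬ N ≤ i}.Finite := (Set.finite_lt_nat N).preimage
    (f := fun i : ℕ+ => (i : ℕ)) PNat.coe_injective.injOn |>.subset
      (fun i hi => by simpa using hi)
  refine summable_of_hasFiniteSupport (hfin.subset fun i hi => ?_)
  intro hNi
  exact hi (by simp [hN i hNi])

theorem L_le_formOperator {κ C : ℝ} (hS : S.OffDiagBound κ C) : S.L ≤ S.formOperator := by
  refine LinearPMap.le_of_le_graph ?_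
  rw [formOperator_graph]
  intro p hp
  obtain ⟨x, hx1, hx2⟩ := (LinearPMap.mem_graph_iff _).1 hp
  have := mem_formGraph_of_mem_H2 (f := S.L x) hS (mem_H2_of_mem_l00 x.2) fun _ => rfl
  rw [hx1, hx2] at this
  exact this

theorem dense_formOperator_domain {κ C : ℝ} (hS : S.OffDiagBound κ C) :
    Dense (S.formOperator.domain : Set S.H) :=
  dense_l00.mono (L_le_formOperator hS).1

theorem formOperator_isSelfAdjoint {κ C : ℝ} (hS : S.OffDiagBound κ C) (hκ : κ < 1 / 4) :
    IsSelfAdjoint S.formOperator := by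
  obtain ⟨c₀, -, h⟩ := formOperator_surjective hS hκ
  exact isSelfAdjoint_of_surjective (dense_formOperator_domain hS) formOperator_isFormalAdjoint
    (h (c₀ + 1) (lt_add_one _))

/-- Surjectivity of `1 - K` yields, for each pair of the form graph, a parametrized pair with the
same image under `c - 𝓛`; dissipativity makes the two coincide. -/
theorem exists_eq_parametrization {κ C : ℝ} (hS : S.OffDiagBound κ C) (hκ : κ < 1 / 4) :
    ∃ (c : ℝ) (D K : S.H →L[ℝ] S.H), (∀ g i, D g i = g i / (S.sigma i + c)) ∧
      (∀ g, D g ∈ S.H2) ∧ (∀ g i, (c • D g - (g - K g)) i = S.Lfun (D g) i) ∧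
      ∀ p ∈ S.formGraph, ∃ g, p = (D g, c • D g - (g - K g)) := by
  obtain ⟨c₀, hc₀, h⟩ := exists_parametrization hS hκ
  have hc : c₀ < c₀ + 1 := lt_add_one _
  obtain ⟨D, K, hsurj, hD, hD2, hL⟩ := h _ hc
  refine ⟨c₀ + 1, D, K, hD, hD2, hL, ?_⟩
  rintro ⟨u, f⟩ hp
  obtain ⟨g, hg⟩ := hsurj ((c₀ + 1) • u - f)
  obtain ⟨x, hx1, hx2⟩ := mem_formGraph_iff.1 (mem_formGraph_of_mem_H2 hS (hD2 g) (hL g))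
  obtain ⟨y, hy1, hy2⟩ := mem_formGraph_iff.1 hp
  have hxy : x = y := by
    refine eq_of_smul_sub_eq formOperator_dissipative (hc₀.trans_lt hc) ?_
    rw [hx1, hx2, hy1, hy2, hg]; abel
  refine ⟨g, ?_⟩
  rw [← hx2, ← hx1, ← hy1, ← hy2, hxy]

theorem formOperator_domain {κ C : ℝ} (hS : S.OffDiagBound κ C) (hκ : κ < 1 / 4) :
    (S.formOperator.domain : Set S.H) = S.H2 := by
  obtain ⟨θ, C', -, -, -, hB⟩ := exists_offDiag_bound hS hκ
  refine Set.Subset.antisymm (fun h hh => ?_) fun h hh => ?_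
  · obtain ⟨c, D, K, -, hD2, -, hp⟩ := exists_eq_parametrization hS hκ
    obtain ⟨g, hg⟩ := hp _ (formOperator_mem_formGraph ⟨h, hh⟩)
    rw [show h = D g from congrArg Prod.fst hg]
    exact hD2 g
  -- On `H2` both `σ h` and `Lfun h + σ h` lie in `ℋ`, hence so does `Lfun h`.
  · have hσ : Summable fun i => S.q i * (S.sigma i * h i) ^ 2 :=
      (summable_sigma_sq hh).congr fun i => by ring
    have h1 := mem_formGraph_of_mem_H2 (f := S.seq _ (hB h hh).1 - S.seq _ hσ) hS hh fun i => by
      simp only [sub_apply, seq_apply]; ring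
    obtain ⟨x, hx, -⟩ := mem_formGraph_iff.1 h1
    rw [← hx]
    exact x.2

theorem L_isClosable {κ C : ℝ} (hS : S.OffDiagBound κ C) (hκ : κ < 1 / 4) : S.L.IsClosable :=
  LinearPMap.IsClosable.leIsClosable (formOperator_isSelfAdjoint hS hκ).isClosed.isClosable
    (L_le_formOperator hS)

theorem Lclosure_eq_formOperator {κ C : ℝ} (hS : S.OffDiagBound κ C) (hκ : κ < 1 / 4) :
    S.Lclosure = S.formOperator := by
  have hcl := (formOperator_isSelfAdjoint hS hκ).isClosed
  refine LinearPMap.eq_of_eq_graph ?_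
  rw [Lclosure, ← (L_isClosable hS hκ).graph_closure_eq_closure_graph]
  refine le_antisymm (Submodule.topologicalClosure_minimal _
    (LinearPMap.le_graph_of_le (L_le_formOperator hS)) hcl) ?_
  rw [formOperator_graph]
  intro p hp
  obtain ⟨c, D, K, hD, -, hL, hp'⟩ := exists_eq_parametrization hS hκ
  obtain ⟨g, rfl⟩ := hp' p hp
  -- `Φ` is continuous and its range contains the form graph. Since `D` is a multiplication
  -- operator, it preserves compact support, so `Φ` sends the dense subspace `l00` into the graph of
  -- `L`.
  let Φ : S.H → S.H × S.H := fun g => (D g, c • D g - (g - K g))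
  have hΦ : Continuous Φ := by fun_prop
  refine map_mem_closure (f := Φ) hΦ (dense_l00 g) fun g hg => ?_
  obtain ⟨N, hN⟩ := hg
  have hDg : D g ∈ S.l00 := ⟨N, fun i hi => by rw [hD, hN i hi, zero_div]⟩
  refine (LinearPMap.mem_graph_iff _).2 ⟨⟨D g, hDg⟩, rfl, H_ext fun i => ?_⟩
  exact (hL g i).symm


/-! ### The off-diagonal bound from the asymptotics of the coefficients -/

theorem exists_bound_of_eventually_le {f : ℕ+ → ℝ} (hf : ∀ᶠ j in atTop, f j ≤ 0) :
    ∃ C, 0 ≤ C ∧ ∀ j, f j ≤ C := by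
  obtain ⟨N, hN⟩ := eventually_atTop.1 hf
  refine ⟨∑ j ∈ Finset.Icc 1 N, |f j|, Finset.sum_nonneg fun _ _ => abs_nonneg _, fun j => ?_⟩
  rcases le_total N j with h | h
  · exact (hN j h).trans (Finset.sum_nonneg fun _ _ => abs_nonneg _)
  · exact (le_abs_self _).trans (Finset.single_le_sum (f := fun j => |f j|)
      (fun _ _ => abs_nonneg _) (Finset.mem_Icc.2 ⟨one_le, h⟩))

theorem tendsto_b_div_a {zs : ℝ} (hzs : 0 < zs)
    (hQ : Tendsto (fun i => Q S.a S.b (i + 1) / Q S.a S.b i) atTop (𝓝 (1 / zs))) :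
    Tendsto (fun i => S.b (i + 1) / S.a i) atTop (𝓝 zs) := by
  have h1 := hQ.inv₀ (one_div_pos.2 hzs).ne'
  rw [one_div, inv_inv] at h1
  refine h1.congr fun i => ?_
  have hQi : Q S.a S.b i ≠ 0 := fun h0 => (S.q_pos i).ne' (by rw [q, h0, zero_mul])
  rw [Q_succ, mul_div_assoc, div_self hQi, mul_one, inv_div]

/-- Both `σ_j` and `σ_{j+1}` are asymptotic to `a_j (z + z_s)`, so `κ` can be taken strictly between
`z z_s / (z + z_s)²` and `1/4`, a gap that is open because `z ≠ z_s`. -/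
theorem exists_offDiagBound {zs : ℝ} (hz : S.z < zs)
    (hQ : Tendsto (fun i => Q S.a S.b (i + 1) / Q S.a S.b i) atTop (𝓝 (1 / zs)))
    (ha : Tendsto (fun i => S.a (i + 1) / S.a i) atTop (𝓝 1)) :
    ∃ κ C, S.OffDiagBound κ C ∧ κ < 1 / 4 := by
  have hz0 := S.z_pos
  have hzs : 0 < zs := hz0.trans hz
  have hr := tendsto_b_div_a hzs hQ
  have hsucc : Tendsto (fun i : ℕ+ => i + 1) atTop atTop :=
    tendsto_atTop_mono (fun i => (PNat.lt_add_right i 1).le) tendsto_id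
  obtain ⟨κ, hκ1, hκ2⟩ := exists_between
    (show S.z * zs / (S.z + zs) ^ 2 < 1 / 4 by
      rw [div_lt_div_iff₀ (by positivity) (by norm_num)]
      nlinarith [pow_pos (sub_pos.2 hz) 2])
  have hκ0 : 0 ≤ κ := (div_nonneg (by positivity) (by positivity)).trans hκ1.le
  rw [div_lt_iff₀ (by positivity)] at hκ1
  obtain ⟨C₁, hC₁, h1⟩ : ∃ C, 0 ≤ C ∧ ∀ j,
      S.a j * S.q 1 * S.b (j + 1) - κ * S.sigma (j + 1) ^ 2 ≤ C := by
    refine exists_bound_of_eventually_le ?_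
    have h2 : Tendsto (fun i => κ * (S.z * (S.a (i + 1) / S.a i) + S.b (i + 1) / S.a i) ^ 2)
        atTop (𝓝 (κ * (S.z * 1 + zs) ^ 2)) := (((ha.const_mul _).add hr).pow 2).const_mul _
    rw [mul_one] at h2
    filter_upwards [(hr.const_mul S.z).eventually_lt h2 hκ1] with i hi
    have hai := S.a_pos i
    have h3 := mul_le_mul_of_nonneg_left hi.le (sq_nonneg (S.a i))
    have e1 : S.a i ^ 2 * (S.z * (S.b (i + 1) / S.a i)) = S.a i * S.q 1 * S.b (i + 1) := by
      rw [q_one]; field_simp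
    have e2 : S.a i ^ 2 * (κ * (S.z * (S.a (i + 1) / S.a i) + S.b (i + 1) / S.a i) ^ 2) =
        κ * S.sigma (i + 1) ^ 2 := by
      rw [sigma_succ, q_one]; field_simp
    rw [e1, e2] at h3
    linarith
  -- The index is shifted because `sigma 1` follows a different formula; the missing case `j = 1` is
  -- put into the constant.
  obtain ⟨C₂, hC₂, h2⟩ : ∃ C, 0 ≤ C ∧ ∀ j,
      S.a (j + 1) * S.q 1 * S.b (j + 1 + 1) - κ * S.sigma (j + 1) ^ 2 ≤ C := by
    refine exists_bound_of_eventually_le ?_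
    have h2 : Tendsto (fun i => κ * (S.z + S.b (i + 1) / S.a i / (S.a (i + 1) / S.a i)) ^ 2)
        atTop (𝓝 (κ * (S.z + zs / 1) ^ 2)) :=
      (((hr.div ha one_ne_zero).const_add _).pow 2).const_mul _
    rw [div_one] at h2
    filter_upwards [((hr.comp hsucc).const_mul S.z).eventually_lt h2 hκ1] with i hi
    have hai := S.a_pos i
    have hai1 := S.a_pos (i + 1)
    have h3 := mul_le_mul_of_nonneg_left hi.le (sq_nonneg (S.a (i + 1)))
    have e1 : S.a (i + 1) ^ 2 * (S.z * ((fun i => S.b (i + 1) / S.a i) ∘ fun i => i + 1) i) =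
        S.a (i + 1) * S.q 1 * S.b (i + 1 + 1) := by
      simp only [Function.comp_apply]
      rw [q_one]; field_simp
    have e2 : S.a (i + 1) ^ 2 *
        (κ * (S.z + S.b (i + 1) / S.a i / (S.a (i + 1) / S.a i)) ^ 2) =
        κ * S.sigma (i + 1) ^ 2 := by
      rw [sigma_succ, q_one]; field_simp
    rw [e1, e2] at h3
    linarith
  have h0 : 0 ≤ S.a 1 * S.q 1 * S.b (1 + 1) :=
    mul_nonneg (mul_pos (S.a_pos 1) (S.q_pos 1)).le (S.b_nonneg _)
  refine ⟨κ, C₁ + C₂ + S.a 1 * S.q 1 * S.b (1 + 1), ⟨hκ0, by positivity, fun j => ?_, fun j => ?_⟩,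
    hκ2⟩
  · induction j using PNat.recOn with
    | one =>
      have := mul_nonneg hκ0 (sq_nonneg (S.sigma 1))
      linarith
    | succ n _ => linarith [h2 n]
  · linarith [h1 j]

/-! ### The conserved mass -/

theorem sigma_succ_le (S : Setting) (i : ℕ+) :
    S.sigma (i + 1) ≤ (1 + S.q 1) * (1 + S.a (i + 1) + S.b (i + 1)) := by
  rw [sigma_succ]
  have h1 := S.q_pos 1
  have h2 := S.a_pos (i + 1)
  have h3 := mul_nonneg h1.le (S.b_nonneg (i + 1))
  linarith

theorem summable_iota (S : Setting) : Summable fun i : ℕ+ => S.q i * (i : ℝ) ^ 2 := by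
  refine Summable.of_nonneg_of_le (fun i => mul_nonneg (S.q_pos i).le (sq_nonneg _))
    (fun i => ?_) S.summable_A
  have h2 : (1 : ℝ) ≤ (1 + S.a i + S.b i) ^ 2 :=
    one_le_pow₀ (by linarith [S.a_pos i, S.b_nonneg i])
  have h3 := mul_le_mul_of_nonneg_right h2 (mul_nonneg (S.q_pos i).le (sq_nonneg (i : ℝ)))
  calc _ = 1 * (S.q i * (i : ℝ) ^ 2) := (one_mul _).symm
    _ ≤ _ := h3
    _ = (i : ℝ) ^ 2 * (1 + S.a i + S.b i) ^ 2 * S.q i := by ring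

/-- The sequence `i ↦ i`, which spans the kernel of the linearized operator. -/
def iota (S : Setting) : S.H := S.seq (fun i => i) S.summable_iota

theorem iota_apply (i : ℕ+) : S.iota i = i := rfl

/-- The moment assumption enters with its full weight `i² (1 + a_i + b_i)²`; the exceptional index
`1` is dropped, since it does not affect summability. -/
theorem iota_mem_H2 : S.iota ∈ S.H2 := by
  refine summable_succ_iff.1 ?_
  have h1 := (summable_succ_iff.2 S.summable_A).mul_left (1 + (1 + S.q 1) ^ 2)
  refine Summable.of_nonneg_of_le (fun i => ?_) (fun i => ?_) h1
  · have := S.q_pos (i + 1)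
    positivity
  · have h2 : S.sigma (i + 1) ^ 2 ≤ ((1 + S.q 1) * (1 + S.a (i + 1) + S.b (i + 1))) ^ 2 :=
      pow_le_pow_left₀ (S.sigma_pos _).le (S.sigma_succ_le i) 2
    have h3 : (1 : ℝ) ≤ (1 + S.a (i + 1) + S.b (i + 1)) ^ 2 :=
      one_le_pow₀ (by linarith [S.a_pos (i + 1), S.b_nonneg (i + 1)])
    have h4 : 1 + S.sigma (i + 1) ^ 2 ≤
        (1 + (1 + S.q 1) ^ 2) * (1 + S.a (i + 1) + S.b (i + 1)) ^ 2 := by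
      rw [mul_pow] at h2; linarith
    have h5 := mul_le_mul_of_nonneg_right h4
      (mul_nonneg (S.q_pos (i + 1)).le (sq_nonneg (((i + 1 : ℕ+) : ℕ) : ℝ)))
    rw [iota_apply]
    calc _ = _ := by ring
      _ ≤ _ := h5
      _ = (1 + (1 + S.q 1) ^ 2) * ((((i + 1 : ℕ+) : ℕ) : ℝ) ^ 2 *
          (1 + S.a (i + 1) + S.b (i + 1)) ^ 2 * S.q (i + 1)) := by ring
      _ = _ := rfl

theorem form_iota (h : S.H) : S.form h S.iota = 0 := by
  have h1 : ∀ i : ℕ+, S.iota (i + 1) - S.iota i - S.iota 1 = 0 := fun i => by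
    simp [iota_apply]
  simp only [form, h1, mul_zero, tsum_zero]

theorem inner_iota (h : S.H) : inner ℝ S.iota h = ∑' i : ℕ+, (i : ℝ) * h i * S.q i := by
  rw [inner_def]
  exact tsum_congr fun i => by rw [iota_apply]; ring

theorem iota_mem_formDomain : S.iota ∈ S.formDomain := by
  have h1 : ∀ i : ℕ+, S.iota (i + 1) - S.iota i - S.iota 1 = 0 := fun i => by
    simp [iota_apply]
  change Summable _
  simp only [h1]
  simp

/-- Conservation of mass: `iota` is additive in the index, so the form vanishes against it. -/
theorem inner_iota_formOperator (x : S.formOperator.domain) :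
    inner ℝ S.iota (S.formOperator x) = (0 : ℝ) := by
  have h1 := (formOperator_mem_formGraph x).2 _ iota_mem_formDomain
  rw [form_iota, real_inner_comm] at h1
  linarith

/-! ### A discrete Hardy inequality and the spectral gap -/

/-- A crude bound obtained by climbing from `g 1 = 0` one increment at a time. It serves the
finitely many indices at which `𝒬` need not yet decay. -/
theorem exists_pointwise_hardy (S : Setting) (i : ℕ+) : ∃ C : ℝ, 0 ≤ C ∧ ∀ g : ℕ+ → ℝ, g 1 = 0 →
    ∀ U : ℝ, (∀ i, S.q i * (g (i + 1) - g i) ^ 2 ≤ U) → S.q i * g i ^ 2 ≤ C * U := by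
  induction i using PNat.recOn with
  | one => exact ⟨0, le_rfl, fun g hg U _ => by simp [hg]⟩
  | succ n ih =>
    obtain ⟨C, hC, h⟩ := ih
    have hq := S.q_pos n
    have hq1 := S.q_pos (n + 1)
    refine ⟨S.q (n + 1) / S.q n * (2 * (C + 1)), by positivity, fun g hg U hU => ?_⟩
    have h1 := h g hg U hU
    have h2 := hU n
    have h3 : g (n + 1) ^ 2 ≤ 2 * (g n ^ 2 + (g (n + 1) - g n) ^ 2) := by
      linarith [sq_nonneg (g n - (g (n + 1) - g n))]
    have h4 : S.q n * g (n + 1) ^ 2 ≤ 2 * (C + 1) * U := by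
      have := mul_le_mul_of_nonneg_left h3 hq.le
      linarith
    calc S.q (n + 1) * g (n + 1) ^ 2 = S.q (n + 1) / S.q n * (S.q n * g (n + 1) ^ 2) := by
          field_simp
      _ ≤ S.q (n + 1) / S.q n * (2 * (C + 1) * U) :=
          mul_le_mul_of_nonneg_left h4 (by positivity)
      _ = _ := by ring

/-- With `δ = 1 - ρ`, Young's inequality for `g_{i+1} = g_i + (g_{i+1} - g_i)` and the decay of `𝒬`
give the contraction factor `(1 - δ)(1 + δ) = 1 - δ²`. As `g 1 = 0`, the shifted sum is again
`‖g‖²`, which is finite, and the term `(1 - δ²) ‖g‖²` can be absorbed. -/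
theorem exists_hardy {ρ : ℝ} (hρ : ρ < 1) (hρ0 : 0 < ρ)
    (hq : ∀ᶠ i in atTop, S.q (i + 1) ≤ ρ * S.q i) :
    ∃ C : ℝ, 0 ≤ C ∧ ∀ g : S.H, g 1 = 0 →
      (Summable fun i => S.q i * (g (i + 1) - g i) ^ 2) →
      ‖g‖ ^ 2 ≤ C * ∑' i, S.q i * (g (i + 1) - g i) ^ 2 := by
  obtain ⟨N, hN⟩ := eventually_atTop.1 hq
  choose c hc0 hc using S.exists_pointwise_hardy
  have hδ : 0 < 1 - ρ := sub_pos.2 hρ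
  set δ := 1 - ρ with hδ_def
  let M : ℝ := ∑ i ∈ Finset.Icc 1 N, c (i + 1)
  have hM : 0 ≤ M := Finset.sum_nonneg fun i _ => hc0 _
  refine ⟨(δ ^ 2)⁻¹ * (1 + δ⁻¹ + M), by positivity, fun g hg hU => ?_⟩
  have hq0 := S.q_pos
  set U := ∑' i, S.q i * (g (i + 1) - g i) ^ 2 with hU_def
  have hu0 : ∀ i, 0 ≤ S.q i * (g (i + 1) - g i) ^ 2 := fun i =>
    mul_nonneg (hq0 i).le (sq_nonneg _)
  have hUi : ∀ i, S.q i * (g (i + 1) - g i) ^ 2 ≤ U := fun i => hU.le_tsum i fun j _ => hu0 j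
  -- Correction for the initial indices, where the decay of `𝒬` is not available.
  let f : ℕ+ → ℝ := fun i => if i ∈ Finset.Icc 1 N then S.q (i + 1) * g (i + 1) ^ 2 else 0
  have hf : HasSum f (∑ i ∈ Finset.Icc 1 N, f i) :=
    hasSum_sum_of_ne_finset_zero fun i hi => if_neg hi
  have hf0 : ∀ i, 0 ≤ f i := fun i => by
    have := hq0 (i + 1)
    simp only [f]
    split_ifs
    · positivity
    · exact le_rfl
  have hfM : ∑ i ∈ Finset.Icc 1 N, f i ≤ M * U := by
    rw [Finset.sum_mul]
    refine Finset.sum_le_sum fun i hi => ?_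
    simp only [f, if_pos hi]
    exact hc (i + 1) g hg U hUi
  have hG := summable_sq g
  have hpt : ∀ i, S.q (i + 1) * g (i + 1) ^ 2 ≤ (1 - δ ^ 2) * (S.q i * g i ^ 2) +
      (1 + δ⁻¹) * (S.q i * (g (i + 1) - g i) ^ 2) + f i := by
    intro i
    have e1 : 0 ≤ 1 - δ ^ 2 := by
      have : 1 - δ ^ 2 = ρ * (1 + δ) := by rw [hδ_def]; ring
      rw [this]; positivity
    rcases le_total i N with hi | hi
    · have h1 : f i = S.q (i + 1) * g (i + 1) ^ 2 := if_pos (Finset.mem_Icc.2 ⟨one_le, hi⟩)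
      rw [h1]
      have h2 := mul_nonneg e1 (mul_nonneg (hq0 i).le (sq_nonneg (g i)))
      have h3 := mul_nonneg (show 0 ≤ 1 + δ⁻¹ by positivity) (hu0 i)
      linarith
    · have h1 : g (i + 1) ^ 2 ≤ (1 + δ) * g i ^ 2 + (1 + δ⁻¹) * (g (i + 1) - g i) ^ 2 := by
        have e2 : 0 ≤ δ * (g i - δ⁻¹ * (g (i + 1) - g i)) ^ 2 := by positivity
        have e3 : δ * (g i - δ⁻¹ * (g (i + 1) - g i)) ^ 2 =
            δ * g i ^ 2 - 2 * g i * (g (i + 1) - g i) + δ⁻¹ * (g (i + 1) - g i) ^ 2 := by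
          field_simp
          ring
        linarith
      have h2 := mul_le_mul (hN i hi) h1 (sq_nonneg _) (mul_nonneg hρ0.le (hq0 i).le)
      have h3 : ρ * S.q i * ((1 + δ⁻¹) * (g (i + 1) - g i) ^ 2) ≤
          (1 + δ⁻¹) * (S.q i * (g (i + 1) - g i) ^ 2) := by
        have := mul_le_mul_of_nonneg_right hρ.le
          (mul_nonneg (show 0 ≤ 1 + δ⁻¹ by positivity) (hu0 i))
        linarith
      have h4 : ρ * S.q i * ((1 + δ) * g i ^ 2) = (1 - δ ^ 2) * (S.q i * g i ^ 2) := by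
        rw [hδ_def]; ring
      linarith [hf0 i]
  have hs1 := (hG.mul_left (1 - δ ^ 2)).add (hU.mul_left (1 + δ⁻¹))
  have h1 := (summable_succ_iff (f := fun i => S.q i * g i ^ 2) |>.2 hG).tsum_le_tsum hpt
    (hs1.add hf.summable)
  rw [hs1.tsum_add hf.summable, (hG.mul_left _).tsum_add (hU.mul_left _), tsum_mul_left,
    tsum_mul_left, hf.tsum_eq, ← norm_sq_def] at h1
  have h2 := tsum_eq_add_tsum_succ hG
  rw [← norm_sq_def, hg] at h2
  rw [mul_assoc, inv_mul_eq_div, le_div_iff₀ (by positivity)]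
  linarith

/-- Subtracting `h 1 • iota` turns `h_{i+1} - h_i - h_1` into a plain increment of a sequence
vanishing at `1`, to which the Hardy inequality applies. Since `h` is orthogonal to `iota`,
Pythagoras shows that the subtraction only increases the norm. -/
theorem exists_form_gap {zs m : ℝ} (hz : S.z < zs) (hm : 0 < m) (hma : ∀ i, m ≤ S.a i)
    (hQ : Tendsto (fun i => Q S.a S.b (i + 1) / Q S.a S.b i) atTop (𝓝 (1 / zs))) :
    ∃ lam : ℝ, 0 < lam ∧ ∀ h ∈ S.formDomain, inner ℝ S.iota h = (0 : ℝ) →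
      lam * ‖h‖ ^ 2 ≤ S.form h h := by
  have hz0 := S.z_pos
  have hzs : 0 < zs := hz0.trans hz
  -- The ratio `𝒬_{i+1} / 𝒬_i` tends to `z / z_s < 1`.
  obtain ⟨ρ, hρ1, hρ2⟩ := exists_between (show 1 / zs * S.z < 1 by
    rw [one_div, inv_mul_eq_div, div_lt_one hzs]; exact hz)
  have hρ0 : 0 < ρ := (by positivity : 0 < 1 / zs * S.z).trans hρ1
  have hq : ∀ᶠ i in atTop, S.q (i + 1) ≤ ρ * S.q i := by
    filter_upwards [(hQ.mul_const S.z).eventually_lt_const hρ1] with i hi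
    have hQi : Q S.a S.b i ≠ 0 := fun h0 => (S.q_pos i).ne' (by rw [q, h0, zero_mul])
    have e : S.q (i + 1) = Q S.a S.b (i + 1) / Q S.a S.b i * S.z * S.q i := by
      rw [q, q, PNat.add_coe, PNat.one_coe, pow_succ]
      field_simp
    rw [e]
    exact mul_le_mul_of_nonneg_right hi.le (S.q_pos i).le
  obtain ⟨C, hC, hH⟩ := exists_hardy hρ2 hρ0 hq
  have hq1 := S.q_pos 1
  -- The Hardy constant may be `0`, so `C + 1` keeps the quotient meaningful and positive.
  refine ⟨m * S.q 1 / (C + 1), by positivity, fun h hh hmass => ?_⟩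
  let g : S.H := h - (h 1) • S.iota
  have hgi : ∀ i, g i = h i - h 1 * i := fun i => rfl
  have hgd : ∀ i, g (i + 1) - g i = h (i + 1) - h i - h 1 := fun i => by
    rw [hgi, hgi, PNat.add_coe, PNat.one_coe]; push_cast; ring
  have hw : ∀ i, S.q i * (g (i + 1) - g i) ^ 2 ≤ (m * S.q 1)⁻¹ *
      (S.a i * S.q i * S.q 1 * (h (i + 1) - h i - h 1) * (h (i + 1) - h i - h 1)) := fun i => by
    rw [hgd, inv_mul_eq_div, le_div_iff₀ (by positivity)]
    have := mul_le_mul_of_nonneg_right (hma i)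
      (mul_nonneg (mul_pos (S.q_pos i) hq1).le (sq_nonneg (h (i + 1) - h i - h 1)))
    linarith
  have hs := (summable_form hh hh).mul_left (m * S.q 1)⁻¹
  have hsg : Summable fun i => S.q i * (g (i + 1) - g i) ^ 2 :=
    Summable.of_nonneg_of_le (fun i => mul_nonneg (S.q_pos i).le (sq_nonneg _)) hw hs
  have h1 := hH g (by simp [hgi]) hsg
  have h2 := hsg.tsum_le_tsum hw hs
  rw [tsum_mul_left] at h2
  change _ ≤ (m * S.q 1)⁻¹ * S.form h h at h2
  have h3 : ‖h‖ ^ 2 ≤ ‖g‖ ^ 2 := by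
    have e : ‖g‖ ^ 2 = ‖h‖ ^ 2 + ‖h 1 • S.iota‖ ^ 2 := by
      rw [norm_sub_sq_real, real_inner_smul_right, real_inner_comm, hmass]; ring
    rw [e]; linarith [sq_nonneg ‖h 1 • S.iota‖]
  have h4 := mul_le_mul_of_nonneg_left h2 hC
  have h5 := form_self_nonneg h
  have h6 : ‖h‖ ^ 2 ≤ (C + 1) * ((m * S.q 1)⁻¹ * S.form h h) := by
    have : 0 ≤ (m * S.q 1)⁻¹ * S.form h h := mul_nonneg (by positivity) h5
    linarith
  have h7 := mul_le_mul_of_nonneg_left h6 (show 0 ≤ m * S.q 1 / (C + 1) by positivity)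
  refine h7.trans_eq ?_
  field_simp

end Setting

end BeckerDoering

end

/-! ### Assembly of the main theorem. -/

theorem mainTheorem7 (S : BeckerDoering.Setting)
    (ha_inf : 0 < ⨅ i, S.a i)
    (hzs_fin : BeckerDoering.criticalDensity S.a S.b ≠ ⊤)
    (hQ_lim : Tendsto (fun i => BeckerDoering.Q S.a S.b (i + 1) / BeckerDoering.Q S.a S.b i) atTop
      (𝓝 (1 / (BeckerDoering.criticalDensity S.a S.b).toReal)))
    (ha_lim : Tendsto (fun i => S.a (i + 1) / S.a i) atTop (𝓝 1))
    (hz : ENNReal.ofReal S.z < BeckerDoering.criticalDensity S.a S.b) :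
    S.L.IsClosable ∧
    IsSelfAdjoint S.Lclosure ∧
    (S.Lclosure.domain : Set S.H) = S.H2 ∧
    S.Lclosure = S.formOperator ∧
    ∃ lam : ℝ, 0 < lam ∧
      (∀ h : S.Lclosure.domain, (h : S.H) ∈ S.massZero →
        inner ℝ (S.Lclosure h) (h : S.H) ≤ -lam * ‖(h : S.H)‖ ^ 2) ∧
      ∃ T : BeckerDoering.C0Semigroup S.H, T.generator = S.Lclosure ∧
        ∀ h ∈ S.massZero, ∀ t : NNReal, ‖T.op t h‖ ≤ Real.exp (-lam * t) * ‖h‖ := by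
  have hz' : S.z < (BeckerDoering.criticalDensity S.a S.b).toReal :=
    (ENNReal.ofReal_lt_iff_lt_toReal S.z_pos.le hzs_fin).1 hz
  have hma : ∀ i, (⨅ i, S.a i) ≤ S.a i := fun i =>
    ciInf_le ⟨0, by rintro _ ⟨j, rfl⟩; exact (S.a_pos j).le⟩ i
  obtain ⟨κ, C, hS, hκ⟩ := BeckerDoering.Setting.exists_offDiagBound hz' hQ_lim ha_lim
  obtain ⟨lam, hlam, hgap⟩ := BeckerDoering.Setting.exists_form_gap hz' ha_inf hma hQ_lim
  obtain ⟨c₀, -, hsurj⟩ := BeckerDoering.Setting.formOperator_surjective hS hκ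
  have hd := BeckerDoering.Setting.dense_formOperator_domain hS
  have hdom := BeckerDoering.Setting.formOperator_domain hS hκ
  have hmass : ∀ h ∈ S.massZero, inner ℝ S.iota h = (0 : ℝ) := fun h hh =>
    (BeckerDoering.Setting.inner_iota h).trans hh
  have hgap' : ∀ x : S.formOperator.domain, inner ℝ S.iota (x : S.H) = (0 : ℝ) →
      inner ℝ (S.formOperator x) (x : S.H) ≤ -lam * ‖(x : S.H)‖ ^ 2 := fun x hx => by
    rw [BeckerDoering.Setting.inner_formOperator_self]
    have := hgap x (BeckerDoering.Setting.formOperator_mem_formGraph x).1 hx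
    linarith
  obtain ⟨T, hT, -⟩ := BeckerDoering.exists_contraction_semigroup hd
    BeckerDoering.Setting.formOperator_dissipative hsurj
  have heq := BeckerDoering.Setting.Lclosure_eq_formOperator hS hκ
  refine ⟨BeckerDoering.Setting.L_isClosable hS hκ, ?_, ?_, heq, lam, hlam, ?_, T, ?_,
    fun h hh t => ?_⟩
  · rw [heq]; exact BeckerDoering.Setting.formOperator_isSelfAdjoint hS hκ
  · rw [heq, hdom]
  · rw [heq]; exact fun x hx => hgap' x (hmass x hx)
  · rw [heq, hT]
  -- Applied with `e = iota`, whose orthogonal complement is the zero-mass subspace.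
  · refine BeckerDoering.C0Semigroup.norm_op_le_exp_mul hT hd ?_
      BeckerDoering.Setting.inner_iota_formOperator hgap' (hmass h hh) t
    rw [← SetLike.mem_coe, hdom]
    exact BeckerDoering.Setting.iota_mem_H2
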